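/- **Setting.** A *quad-equation* is an equation $Q=0$ where $Q=Q(x,y,z,w)\in\mathbb{C}[x,y,z,w]$ is irreducible over $\mathbb{C}$ and of degree exactly $1$ in each of its four variables. Let $u_1,\dots,u_6$ be variables attached to the vertices of an octahedron, with opposite pairs $\{u_1,u_4\}$, $\{u_2,u_5\}$, $\{u_3,u_6\}$. An *octahedron with quad-equations* $\{Q_1,Q_2,Q_3\}$ consists of three quad-equations $$Q_1(u_4,u_2,u_1,u_5)=0,\qquad Q_2(u_2,u_6,u_5,u_3)=0,\qquad Q_3(u_6,u_4,u_3,u_1)=0 .$$ It has the *consistency around an octahedron (CAO) property* if each of the three equations can be obtained from the other two: whenever one of the other two equations is solved for a variable that does not occur in the second, and the second is solved for a variable that does not occur in the first (the remaining four variables being arbitrary initial values for which these linear equations are uniquely solvable), the resulting values satisfy the remaining equation. Let $G^{(o)}=\langle (1\,4),(2\,5),(3\,6),(2\,3\,5\,6),(1\,3\,4\,6),(1\,2\,4\,5)\rangle\le\mathfrak{S}_6$ act by $\sigma.u_i=u_{\sigma(i)}$. A Möbius transformation $r$ acts by $r.u_i=\frac{A_iu_i+B_i}{C_iu_i+D_i}$,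 $A_iD_i-B_iC_i\neq0$ ($i=1,\dots,6$, independently for each $i$), and on a polynomial by substitution followed by multiplication with $C_iu_i+D_i$ for each of the variables $u_i$ of the quad-equation. Write $\{P,Q,R\}\sim_o\{P',Q',R'\}$ if there are a Möbius transformation $r$ and $\sigma\in G^{(o)}$ such that $\{P',Q',R'\}$ and $\{r.\sigma.P,\,r.\sigma.Q,\,r.\sigma.R\}$ agree as unordered triples of polynomials up to nonzero constant factors. Put $$\begin{aligned} \mathrm{N3}(x,y,z,w;\alpha_1,\alpha_2,\alpha_3,\alpha_4)&=\alpha_1xy+\alpha_2zw+\alpha_3xw+\alpha_4yz,\\ \mathrm{N2}(x,y,z,w;\alpha_1,\alpha_2,\alpha_3,\alpha_4)&=(x+z)(\alpha_1y+\alpha_2w)+\alpha_3y+\alpha_4w,\\ \mathrm{N1}(x,y,z,w;\alpha_1,\alpha_2,\alpha_3,\alpha_4)&=\alpha_1(x+z)(y+w)+\alpha_2(x+z)+\alpha_3(y+w)+\alpha_4 . \end{aligned}$$ **Lemma (CAO classification).** Every octahedron with quad-equations $\{Q_1,Q_2,Q_3\}$ that has the CAO property is equivalent under $\sim_o$ to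 one of the following four systems, for some $\alpha_1,\dots,\alpha_8\in\mathbb{C}$, where $\alpha_{i,j}=\alpha_i\alpha_j$: $$\begin{cases} \mathrm{N3}(u_4,u_2,u_1,u_5;\alpha_1,\alpha_2,\alpha_3,\alpha_4),\\ \mathrm{N3}(u_2,u_6,u_5,u_3;\alpha_5,\alpha_6,\alpha_7,\alpha_8),\\ \mathrm{N3}(u_6,u_4,u_3,u_1;\alpha_{1,8}-\alpha_{3,5},\,\alpha_{4,6}-\alpha_{2,7},\,\alpha_{4,8}-\alpha_{2,5},\,\alpha_{1,6}-\alpha_{3,7}); \end{cases}$$ $$\begin{cases} \mathrm{N2}(u_2,u_4,u_5,u_1;\alpha_1,\alpha_2,\alpha_3,\alpha_4),\\ \mathrm{N2}(u_2,u_6,u_5,u_3;\alpha_5,\alpha_6,\alpha_7,\alpha_8),\\ \mathrm{N3}(u_6,u_4,u_3,u_1;\alpha_{3,5}-\alpha_{1,7},\,\alpha_{4,6}-\alpha_{2,8},\,\alpha_{4,5}-\alpha_{2,7},\,\alpha_{3,6}-\alpha_{1,8}); \end{cases}$$ $$\begin{cases} \mathrm{N2}(u_4,u_2,u_1,u_5;\alpha_1,\alpha_2,\alpha_3,\alpha_4),\\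 \mathrm{N2}(u_6,u_2,u_3,u_5;\alpha_5,\alpha_6,\alpha_7,\alpha_8),\\ \mathrm{N1}(u_6,u_4,u_3,u_1;\alpha_{2,5}-\alpha_{1,6},\,\alpha_{4,5}-\alpha_{3,6},\,\alpha_{2,7}-\alpha_{1,8},\,\alpha_{4,7}-\alpha_{3,8}); \end{cases}$$ $$\begin{cases} \mathrm{N1}(u_4,u_2,u_1,u_5;\alpha_1,\alpha_2,\alpha_3,\alpha_4),\\ \mathrm{N1}(u_2,u_6,u_5,u_3;\alpha_5,\alpha_6,\alpha_7,\alpha_8),\\ \mathrm{N1}(u_6,u_4,u_3,u_1;\alpha_{2,5}-\alpha_{1,7},\,\alpha_{4,5}-\alpha_{3,7},\,\alpha_{2,6}-\alpha_{1,8},\,\alpha_{4,6}-\alpha_{3,8}). \end{cases}$$ -/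

import Mathlib

open MvPolynomial

namespace CAO

/-- A quad-equation `Q(x,y,z,w) = 0`, represented by its polynomial: `Q` is affine-linear in each of
its four variables, really depends on each of them, and is irreducible over `ℂ`. -/
def IsQuadEquation (Q : MvPolynomial (Fin 4) ℂ) : Prop :=
  Irreducible Q ∧ ∀ i, Q.degreeOf i = 1

/-- The six vertex variables `u₁, …, u₆` of the octahedron are indexed by their labels modulo `6`;
thus `u₆` is the variable with index `(6 : Fin 6) = 0`. Opposite vertices are `1,4`; `2,5`; `3,6`. -/
noncomputable abbrev u (i : Fin 6) : MvPolynomial (Fin 6) ℂ := X i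

/-- The three quad-equations `Q₁(u₄,u₂,u₁,u₅)`, `Q₂(u₂,u₆,u₅,u₃)`, `Q₃(u₆,u₄,u₃,u₁)` placed on the
three interior quadrilaterals of the octahedron. -/
noncomputable def octahedron (Q₁ Q₂ Q₃ : MvPolynomial (Fin 4) ℂ) :
    Fin 3 → MvPolynomial (Fin 6) ℂ :=
  ![rename ![4, 2, 1, 5] Q₁, rename ![2, 6, 5, 3] Q₂, rename ![6, 4, 3, 1] Q₃]

/-- The equation `R = 0` is obtained from `P = 0` and `Q = 0`: whenever `P = 0` is solved for a
vertex variable `u_a` that does not occur in `Q`, and `Q = 0` is solved for a vertex variable `u_b`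
that does not occur in `P` (the other four variables being initial values), the result satisfies
`R = 0`. As `P` is affine-linear in `u_a`, it can be solved (uniquely) for `u_a` exactly when
`∂P/∂u_a ≠ 0`; likewise for `Q`. -/
def ObtainedFrom (R P Q : MvPolynomial (Fin 6) ℂ) : Prop :=
  ∀ a ∈ P.vars \ Q.vars, ∀ b ∈ Q.vars \ P.vars, ∀ v : Fin 6 → ℂ,
    eval v (pderiv a P) ≠ 0 → eval v (pderiv b Q) ≠ 0 →
      eval v P = 0 → eval v Q = 0 → eval v R = 0

/-- Consistency around an octahedron: each of the three equations is obtained from the other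
two. -/
def HasCAO (E : Fin 3 → MvPolynomial (Fin 6) ℂ) : Prop :=
  ObtainedFrom (E 0) (E 1) (E 2) ∧ ObtainedFrom (E 1) (E 0) (E 2) ∧ ObtainedFrom (E 2) (E 0) (E 1)

/-- The symmetry group of the octahedron, as a group of permutations of the vertex labels. -/
def octahedralGroup : Subgroup (Equiv.Perm (Fin 6)) :=
  Subgroup.closure
    {Equiv.swap 1 4, Equiv.swap 2 5, Equiv.swap 3 6,
      [2, 3, 5, 6].formPerm, [1, 3, 4, 6].formPerm, [1, 2, 4, 5].formPerm}

/-- Action of the Möbius transformation `uᵢ ↦ (Aᵢ uᵢ + Bᵢ) / (Cᵢ uᵢ + Dᵢ)`, where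
`r i = !![Aᵢ, Bᵢ; Cᵢ, Dᵢ]`, on a polynomial: the substitution is made and the denominators are
cleared, i.e. the result is `∏ᵢ (Cᵢ uᵢ + Dᵢ) ^ deg_{uᵢ} P` times `P` at the transformed variables.
(No subtraction is truncated, as `m i ≤ degreeOf i P` for each monomial `m` of `P`.) -/
noncomputable def mobius (r : Fin 6 → Matrix (Fin 2) (Fin 2) ℂ) (P : MvPolynomial (Fin 6) ℂ) :
    MvPolynomial (Fin 6) ℂ :=
  ∑ m ∈ P.support, C (P.coeff m) *
    ∏ i, (C (r i 0 0) * u i + C (r i 0 1)) ^ m i *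
      (C (r i 1 0) * u i + C (r i 1 1)) ^ (P.degreeOf i - m i)

/-- Equivalence of triples of quad-equations on the octahedron modulo Möbius transformations of the
six variables and the octahedral symmetries `σ.uᵢ = u_{σ(i)}`: after such a transformation the
two unordered triples agree up to nonzero constant factors. -/
def OctEquiv (E E' : Fin 3 → MvPolynomial (Fin 6) ℂ) : Prop :=
  ∃ r : Fin 6 → Matrix (Fin 2) (Fin 2) ℂ, (∀ i, (r i).det ≠ 0) ∧
    ∃ σ ∈ octahedralGroup, ∃ τ : Equiv.Perm (Fin 3), ∀ i, ∃ c : ℂ, c ≠ 0 ∧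
      E' i = C c * mobius r (rename σ (E (τ i)))

noncomputable def N3 (x y z w : MvPolynomial (Fin 6) ℂ) (α₁ α₂ α₃ α₄ : ℂ) :
    MvPolynomial (Fin 6) ℂ :=
  C α₁ * (x * y) + C α₂ * (z * w) + C α₃ * (x * w) + C α₄ * (y * z)

noncomputable def N2 (x y z w : MvPolynomial (Fin 6) ℂ) (α₁ α₂ α₃ α₄ : ℂ) :
    MvPolynomial (Fin 6) ℂ :=
  (x + z) * (C α₁ * y + C α₂ * w) + C α₃ * y + C α₄ * w

noncomputable def N1 (x y z w : MvPolynomial (Fin 6) ℂ) (α₁ α₂ α₃ α₄ : ℂ) :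
    MvPolynomial (Fin 6) ℂ :=
  C α₁ * ((x + z) * (y + w)) + C α₂ * (x + z) + C α₃ * (y + w) + C α₄

noncomputable def systemN333 (α₁ α₂ α₃ α₄ α₅ α₆ α₇ α₈ : ℂ) : Fin 3 → MvPolynomial (Fin 6) ℂ :=
  ![N3 (u 4) (u 2) (u 1) (u 5) α₁ α₂ α₃ α₄,
    N3 (u 2) (u 6) (u 5) (u 3) α₅ α₆ α₇ α₈,
    N3 (u 6) (u 4) (u 3) (u 1)
      (α₁ * α₈ - α₃ * α₅) (α₄ * α₆ - α₂ * α₇) (α₄ * α₈ - α₂ * α₅) (α₁ * α₆ - α₃ * α₇)]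

noncomputable def systemN223 (α₁ α₂ α₃ α₄ α₅ α₆ α₇ α₈ : ℂ) : Fin 3 → MvPolynomial (Fin 6) ℂ :=
  ![N2 (u 2) (u 4) (u 5) (u 1) α₁ α₂ α₃ α₄,
    N2 (u 2) (u 6) (u 5) (u 3) α₅ α₆ α₇ α₈,
    N3 (u 6) (u 4) (u 3) (u 1)
      (α₃ * α₅ - α₁ * α₇) (α₄ * α₆ - α₂ * α₈) (α₄ * α₅ - α₂ * α₇) (α₃ * α₆ - α₁ * α₈)]

noncomputable def systemN221 (α₁ α₂ α₃ α₄ α₅ α₆ α₇ α₈ : ℂ) : Fin 3 → MvPolynomial (Fin 6) ℂ :=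
  ![N2 (u 4) (u 2) (u 1) (u 5) α₁ α₂ α₃ α₄,
    N2 (u 6) (u 2) (u 3) (u 5) α₅ α₆ α₇ α₈,
    N1 (u 6) (u 4) (u 3) (u 1)
      (α₂ * α₅ - α₁ * α₆) (α₄ * α₅ - α₃ * α₆) (α₂ * α₇ - α₁ * α₈) (α₄ * α₇ - α₃ * α₈)]

noncomputable def systemN111 (α₁ α₂ α₃ α₄ α₅ α₆ α₇ α₈ : ℂ) : Fin 3 → MvPolynomial (Fin 6) ℂ :=
  ![N1 (u 4) (u 2) (u 1) (u 5) α₁ α₂ α₃ α₄,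
    N1 (u 2) (u 6) (u 5) (u 3) α₅ α₆ α₇ α₈,
    N1 (u 6) (u 4) (u 3) (u 1)
      (α₂ * α₅ - α₁ * α₇) (α₄ * α₅ - α₃ * α₇) (α₂ * α₆ - α₁ * α₈) (α₄ * α₆ - α₃ * α₈)]

end CAO

namespace CAO

open Matrix

/-! Group the variables into opposite pairs. A multi-affine polynomial on two pairs is a bilinear
form in the vectors `(1, z, x, xz)` of the pairs, so the three equations become 4×4 matrices `M₁,
M₂, M₃`, each pair being shared by two of them. Irreducibility gives two facts: no matrix has rank
at most one (`IsQuadEquation.ne_vecMulVec`), and for generic values of one pair the remaining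
bilinear polynomial in the other pair is nondegenerate (`IsQuadEquation.detPoly_ne_zero`).

Fix generic values of the shared pair of two equations. Each equation then cuts out a nondegenerate
curve in its other pair, and a bilinear polynomial vanishing on such a curve is a multiple of its
equation (`exists_eq_smul_of_vanishing`). Consistency thus forces the third matrix to have rank 2
and its range to contain that of its neighbour (`Consistent.range_le`). By cyclic symmetry both
equations at a pair span the same two-dimensional pencil of bilinear polynomials in that pair.

Over `ℂ` a pencil with a nondegenerate member is brought by Möbius transformations to the span of
`x, z` or of `x + z, 1` (`exists_pencil_basis`). What remains of the equations is three invertible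
2×2 matrices, each determined up to scale and transposition by the other two as `A J B` with `J`
skew (`Consistent.exists_eq_smul`). Among three pairs with two possible types, two agree; rotating
these into a fixed position leaves the four listed systems. -/

/-! ### Quad-equations as bilinear forms on opposite pairs -/

/-- The monomials `1, x, z, x z`, indexed by exponents. -/
def mon {R : Type*} [CommRing R] (x z : R) (I : Fin 2 × Fin 2) : R := x ^ (I.1 : ℕ) * z ^ (I.2 : ℕ)

/-- The multi-affine polynomial in two pairs of variables with coefficient matrix `M`; the pairs are
formed by opposite variables. -/
noncomputable def quad (M : Matrix (Fin 2 × Fin 2) (Fin 2 × Fin 2) ℂ) : MvPolynomial (Fin 4) ℂ :=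
  ∑ I, ∑ J, C (M I J) * (mon (X 0) (X 2) I * mon (X 1) (X 3) J)

/-- Regrouping four binary exponents into two pairs. -/
def pairsEquiv : (Fin 2 × Fin 2) × (Fin 2 × Fin 2) ≃ (Fin 4 → Fin 2) where
  toFun p := ![p.1.1, p.2.1, p.1.2, p.2.2]
  invFun s := ((s 0, s 2), (s 1, s 3))
  left_inv p := by rfl
  right_inv s := by ext i; fin_cases i <;> rfl

theorem pairsEquiv_apply (I J : Fin 2 × Fin 2) : pairsEquiv (I, J) = ![I.1, J.1, I.2, J.2] := rfl

/-- The exponent vector with entries in `{0, 1}` given by `s`. -/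
noncomputable def expo (s : Fin 4 → Fin 2) : Fin 4 →₀ ℕ :=
  Finsupp.equivFunOnFinite.symm fun i => (s i : ℕ)

theorem expo_injective : Function.Injective expo := by
  intro s t h
  funext i
  have := DFunLike.congr_fun h i
  simpa [expo, Fin.ext_iff] using this

theorem sum_support_eq_sum_pairs {A : Type*} [AddCommMonoid A] {Q : MvPolynomial (Fin 4) ℂ}
    (hQ : ∀ i, Q.degreeOf i ≤ 1) (f : (Fin 4 →₀ ℕ) → ℂ → A) (hf : ∀ m, f m 0 = 0) :
    ∑ m ∈ Q.support, f m (Q.coeff m) =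
      ∑ I, ∑ J, f (expo (pairsEquiv (I, J))) (Q.coeff (expo (pairsEquiv (I, J)))) := by
  classical
  rw [← Fintype.sum_prod_type', pairsEquiv.sum_comp (fun s => f (expo s) (Q.coeff (expo s))),
    ← Finset.sum_image (s := Finset.univ) (g := expo) (f := fun m => f m (Q.coeff m))
      (fun a _ b _ h => expo_injective h)]
  refine Finset.sum_subset ?_ ?_
  · intro m hm
    rw [Finset.mem_image]
    refine ⟨fun i => ⟨m i, ?_⟩, Finset.mem_univ _, ?_⟩
    · have := (MvPolynomial.monomial_le_degreeOf i hm).trans (hQ i)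
      omega
    · ext i
      simp [expo]
  · intro m _ hm
    rw [notMem_support_iff.1 hm, hf]

theorem monomial_expo_pairs (I J : Fin 2 × Fin 2) (c : ℂ) :
    monomial (expo (pairsEquiv (I, J))) c = C c * (mon (X 0) (X 2) I * mon (X 1) (X 3) J) := by
  rw [monomial_eq, Finsupp.prod_fintype _ _ (by simp)]
  simp only [pairsEquiv_apply, Fin.prod_univ_four, expo, mon, Finsupp.equivFunOnFinite_symm_apply_apply,
    cons_val]
  ring

theorem exists_eq_quad {Q : MvPolynomial (Fin 4) ℂ} (hQ : ∀ i, Q.degreeOf i ≤ 1) :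
    ∃ M, Q = quad M := by
  refine ⟨fun I J => Q.coeff (expo (pairsEquiv (I, J))), ?_⟩
  conv_lhs => rw [Q.as_sum]
  rw [sum_support_eq_sum_pairs hQ (fun m c => monomial m c) (by simp)]
  simp only [monomial_expo_pairs, quad]

theorem rename_mon {σ τ : Type*} (f : σ → τ) (a b : σ) (I : Fin 2 × Fin 2) :
    rename f (mon (X a) (X b) I : MvPolynomial σ ℂ) = mon (X (f a)) (X (f b)) I := by
  simp [mon]

theorem eval_mon {σ : Type*} (v : σ → ℂ) (x z : MvPolynomial σ ℂ) (I : Fin 2 × Fin 2) :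
    eval v (mon x z I) = mon (eval v x) (eval v z) I := by
  simp [mon]

theorem eval_quad (M : Matrix (Fin 2 × Fin 2) (Fin 2 × Fin 2) ℂ) (v : Fin 4 → ℂ) :
    eval v (quad M) = mon (v 0) (v 2) ⬝ᵥ M *ᵥ mon (v 1) (v 3) := by
  simp only [quad, map_sum, map_mul, eval_C, eval_mon, eval_X, dotProduct, mulVec, Finset.mul_sum]
  refine Finset.sum_congr rfl fun I _ => Finset.sum_congr rfl fun J _ => ?_
  ring

theorem rename_swap_quad (M : Matrix (Fin 2 × Fin 2) (Fin 2 × Fin 2) ℂ) :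
    rename ![1, 0, 3, 2] (quad M) = quad Mᵀ := by
  simp only [quad, map_sum, map_mul, rename_C, rename_mon]
  rw [Finset.sum_comm]
  refine Finset.sum_congr rfl fun I _ => Finset.sum_congr rfl fun J _ => ?_
  simp [mul_comm]

/-- Transposition exchanges the two opposite pairs, which is a mere renaming of variables. -/
theorem IsQuadEquation.transpose {M : Matrix (Fin 2 × Fin 2) (Fin 2 × Fin 2) ℂ}
    (h : IsQuadEquation (quad M)) : IsQuadEquation (quad Mᵀ) := by
  let e : Equiv.Perm (Fin 4) :=
    ⟨![1, 0, 3, 2], ![1, 0, 3, 2], by decide, by decide⟩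
  have he : rename e (quad M) = quad Mᵀ := rename_swap_quad M
  rw [← he]
  refine ⟨?_, fun i => ?_⟩
  · exact (MulEquiv.irreducible_iff (renameEquiv ℂ e)).2 h.1
  · obtain ⟨j, rfl⟩ := e.surjective i
    rw [degreeOf_rename_of_injective e.injective]
    exact h.2 j

/-! ### What irreducibility says about the coefficient matrix -/

/-- The multi-affine polynomial in two variables with coefficient vector `ℓ`. -/
noncomputable def linPoly (ℓ : Fin 2 × Fin 2 → ℂ) : MvPolynomial (Fin 2) ℂ :=
  ∑ I, C (ℓ I) * mon (X 0) (X 1) I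

theorem eval_linPoly (ℓ : Fin 2 × Fin 2 → ℂ) (v : Fin 2 → ℂ) :
    eval v (linPoly ℓ) = ℓ ⬝ᵥ mon (v 0) (v 1) := by
  simp [linPoly, dotProduct, eval_mon]

theorem linPoly_eq_zero {ℓ : Fin 2 × Fin 2 → ℂ} (h : linPoly ℓ = 0) : ℓ = 0 := by
  have key : ∀ s t : ℂ, ℓ ⬝ᵥ mon s t = 0 := fun s t => by
    have := eval_linPoly ℓ ![s, t]
    rw [h] at this
    simpa using this.symm
  have h00 := key 0 0
  have h10 := key 1 0
  have h01 := key 0 1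
  have h11 := key 1 1
  simp [dotProduct, Fintype.sum_prod_type, mon] at h00 h10 h01 h11
  funext ⟨i, j⟩
  fin_cases i <;> fin_cases j <;> simp_all

theorem degreeOf_rename_of_notMem_range {σ τ : Type*} {f : σ → τ} {i : τ} (hi : i ∉ Set.range f)
    (p : MvPolynomial σ ℂ) : (rename f p).degreeOf i = 0 := by
  classical
  rw [← Nat.le_zero, degreeOf_le_iff]
  intro m hm
  obtain ⟨d, rfl, -⟩ := coeff_rename_ne_zero f p m (mem_support_iff.1 hm)
  rw [Finsupp.mapDomain_of_notMem_range _ _ hi]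

theorem rename_linPoly {σ : Type*} (f : Fin 2 → σ) (ℓ : Fin 2 × Fin 2 → ℂ) :
    rename f (linPoly ℓ) = ∑ I, C (ℓ I) * mon (X (f 0)) (X (f 1)) I := by
  simp [linPoly, rename_mon]

/-- Rank at most one would split the polynomial into a factor in one pair times a factor in the
other; since all variables occur, neither factor can be a unit. -/
theorem IsQuadEquation.ne_vecMulVec {M : Matrix (Fin 2 × Fin 2) (Fin 2 × Fin 2) ℂ}
    (h : IsQuadEquation (quad M)) (a b : Fin 2 × Fin 2 → ℂ) : M ≠ vecMulVec a b := by
  rintro rfl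
  have hfac : quad (vecMulVec a b) = rename ![0, 2] (linPoly a) * rename ![1, 3] (linPoly b) := by
    rw [rename_linPoly, rename_linPoly, quad, Finset.sum_mul_sum]
    refine Finset.sum_congr rfl fun I _ => Finset.sum_congr rfl fun J _ => ?_
    simp [vecMulVec_apply]
    ring
  have h0 : (rename ![1, 3] (linPoly b) : MvPolynomial (Fin 4) ℂ).degreeOf 0 = 0 :=
    degreeOf_rename_of_notMem_range (by simp) _
  have h1 : (rename ![0, 2] (linPoly a) : MvPolynomial (Fin 4) ℂ).degreeOf 1 = 0 :=
    degreeOf_rename_of_notMem_range (by simp) _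
  rcases h.1.isUnit_or_isUnit hfac with hu | hu
  · obtain ⟨c, -, hc⟩ := isUnit_iff_eq_C_of_isReduced.1 hu
    have := h.2 0
    rw [hfac, hc] at this
    have h2 := degreeOf_C_mul_le (rename ![1, 3] (linPoly b) : MvPolynomial (Fin 4) ℂ) 0 c
    omega
  · obtain ⟨c, -, hc⟩ := isUnit_iff_eq_C_of_isReduced.1 hu
    have := h.2 1
    rw [hfac, hc, mul_comm] at this
    have h2 := degreeOf_C_mul_le (rename ![0, 2] (linPoly a) : MvPolynomial (Fin 4) ℂ) 1 c
    omega

/-- The determinant of a quadruple read as a `2 × 2` matrix. -/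
def det2 {R : Type*} [CommRing R] (p : Fin 2 × Fin 2 → R) : R :=
  p (0, 0) * p (1, 1) - p (0, 1) * p (1, 0)

/-- The determinant of `M *ᵥ mon s t`, as a polynomial in `s` and `t`. -/
noncomputable def detPoly (M : Matrix (Fin 2 × Fin 2) (Fin 2 × Fin 2) ℂ) :
    MvPolynomial (Fin 2) ℂ :=
  det2 fun I => linPoly (M I)

theorem eval_detPoly (M : Matrix (Fin 2 × Fin 2) (Fin 2 × Fin 2) ℂ) (v : Fin 2 → ℂ) :
    eval v (detPoly M) = det2 (M *ᵥ mon (v 0) (v 1)) := by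
  simp [detPoly, det2, eval_linPoly, mulVec]

/-- If the determinant vanished, `p (1, 1) * quad M` would be a product of a factor free of `X 2`
and a factor free of `X 0`. The prime `quad M` contains both variables, so it divides neither factor
unless that factor is zero. This forces `p (1, 1) = 0`, after which one of the two variables is
missing from `quad M`. -/
theorem IsQuadEquation.detPoly_ne_zero {M : Matrix (Fin 2 × Fin 2) (Fin 2 × Fin 2) ℂ}
    (h : IsQuadEquation (quad M)) : detPoly M ≠ 0 := by
  intro hdet
  let p : Fin 2 × Fin 2 → MvPolynomial (Fin 4) ℂ := fun I => rename ![1, 3] (linPoly (M I))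
  have hQ : quad M = p (0, 0) + p (1, 0) * X 0 + p (0, 1) * X 2 + p (1, 1) * (X 0 * X 2) := by
    simp only [p, rename_linPoly, quad, Fintype.sum_prod_type, Fin.sum_univ_two, mon]
    simp
    ring
  have hp0 : ∀ I, (p I).degreeOf 0 = 0 := fun I => degreeOf_rename_of_notMem_range (by simp) _
  have hp2 : ∀ I, (p I).degreeOf 2 = 0 := fun I => degreeOf_rename_of_notMem_range (by simp) _
  have hrel : p (0, 0) * p (1, 1) = p (0, 1) * p (1, 0) := by
    have := congrArg (rename (![1, 3] : Fin 2 → Fin 4)) hdet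
    simp only [detPoly, det2, map_sub, map_mul, map_zero] at this
    exact sub_eq_zero.1 this
  have hdeg0 : ∀ a b, (p a + p b * X 2).degreeOf 0 = 0 := fun a b => by
    have h1 := degreeOf_add_le (0 : Fin 4) (p a) (p b * X 2)
    have h2 := degreeOf_mul_le (0 : Fin 4) (p b) (X 2)
    rw [degreeOf_X, hp0] at h2
    rw [hp0] at h1
    simp at h2
    simpa [h2] using h1
  have hdeg2 : ∀ a b, (p a + p b * X 0).degreeOf 2 = 0 := fun a b => by
    have h1 := degreeOf_add_le (2 : Fin 4) (p a) (p b * X 0)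
    have h2 := degreeOf_mul_le (2 : Fin 4) (p b) (X 0)
    rw [degreeOf_X, hp2] at h2
    rw [hp2] at h1
    simp at h2
    simpa [h2] using h1
  have hfac : p (1, 1) * quad M = (p (0, 1) + p (1, 1) * X 0) * (p (1, 0) + p (1, 1) * X 2) := by
    rw [hQ]
    linear_combination hrel
  have hne : quad M ≠ 0 := h.1.ne_zero
  have hdvd0 : ∀ q : MvPolynomial (Fin 4) ℂ, q.degreeOf 0 = 0 → quad M ∣ q → q = 0 := by
    rintro q hq ⟨g, rfl⟩
    by_contra hg
    have hg' : g ≠ 0 := right_ne_zero_of_mul hg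
    rw [degreeOf_mul_eq hne hg', h.2 0] at hq
    omega
  have hdvd2 : ∀ q : MvPolynomial (Fin 4) ℂ, q.degreeOf 2 = 0 → quad M ∣ q → q = 0 := by
    rintro q hq ⟨g, rfl⟩
    by_contra hg
    have hg' : g ≠ 0 := right_ne_zero_of_mul hg
    rw [degreeOf_mul_eq hne hg', h.2 2] at hq
    omega
  have hp11 : p (1, 1) = 0 := by
    by_contra h11
    have hX : ∀ (i : Fin 4) (a : MvPolynomial (Fin 4) ℂ), a.degreeOf i = 0 →
        (p (1, 1)).degreeOf i = 0 → a + p (1, 1) * X i ≠ 0 := by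
      intro i a ha hp h0
      have h3 : a = -(p (1, 1)) * X i := by linear_combination h0
      have h4 := degreeOf_mul_eq (n := i) (neg_ne_zero.2 h11) (X_ne_zero (R := ℂ) i)
      rw [← h3, ha, degreeOf_X] at h4
      simp at h4
    rcases h.1.prime.dvd_or_dvd (Dvd.intro_left _ hfac) with hd | hd
    · exact hX 0 _ (hp0 _) (hp0 _) (hdvd2 _ (hdeg2 _ _) hd)
    · exact hX 2 _ (hp2 _) (hp2 _) (hdvd0 _ (hdeg0 _ _) hd)
  have hprod : p (0, 1) * p (1, 0) = 0 := by rw [← hrel, hp11, mul_zero]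
  rcases mul_eq_zero.1 hprod with h0 | h0
  · have h5 := h.2 2
    rw [hQ, h0, hp11] at h5
    simp only [zero_mul, add_zero] at h5
    rw [hdeg2] at h5
    omega
  · have h5 := h.2 0
    rw [hQ, h0, hp11] at h5
    simp only [zero_mul, add_zero] at h5
    rw [hdeg0] at h5
    omega

/-! ### Consistency forces equal pencils -/

/-- The derivative of `mon s t` with respect to `s`. -/
def dmon (t : ℂ) (I : Fin 2 × Fin 2) : ℂ := (I.1 : ℕ) * t ^ (I.2 : ℕ)

theorem eval_pderiv_zero_quad (M : Matrix (Fin 2 × Fin 2) (Fin 2 × Fin 2) ℂ) (v : Fin 4 → ℂ) :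
    eval v (pderiv 0 (quad M)) = dmon (v 2) ⬝ᵥ M *ᵥ mon (v 1) (v 3) := by
  simp [quad, Fintype.sum_prod_type, Fin.sum_univ_two, mon, dmon, dotProduct, mulVec, pderiv_X]
  ring

theorem eval_pderiv_one_quad (M : Matrix (Fin 2 × Fin 2) (Fin 2 × Fin 2) ℂ) (v : Fin 4 → ℂ) :
    eval v (pderiv 1 (quad M)) = mon (v 0) (v 2) ⬝ᵥ M *ᵥ dmon (v 3) := by
  simp [quad, Fintype.sum_prod_type, Fin.sum_univ_two, mon, dmon, dotProduct, mulVec, pderiv_X]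
  ring

/-- The equation with coefficient matrix `C` follows from those with coefficient matrices `A` and
`B`, where `A` and `B` share a pair of variables. -/
def Consistent (A B C : Matrix (Fin 2 × Fin 2) (Fin 2 × Fin 2) ℂ) : Prop :=
  ∀ x x' y y' z z' : ℂ,
    dmon x' ⬝ᵥ A *ᵥ mon y y' ≠ 0 → mon y y' ⬝ᵥ B *ᵥ dmon z' ≠ 0 →
      mon x x' ⬝ᵥ A *ᵥ mon y y' = 0 → mon y y' ⬝ᵥ B *ᵥ mon z z' = 0 →
        mon x x' ⬝ᵥ C *ᵥ mon z z' = 0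

/-- Eliminating `s` leaves a polynomial in `t` that vanishes identically, and its coefficients being
zero is proportionality of `ℓ` to `p`. -/
theorem exists_eq_smul_of_vanishing {p ℓ : Fin 2 × Fin 2 → ℂ} (hp : det2 p ≠ 0)
    (h : ∀ s t, dmon t ⬝ᵥ p ≠ 0 → mon s t ⬝ᵥ p = 0 → mon s t ⬝ᵥ ℓ = 0) : ∃ c : ℂ, ℓ = c • p := by
  simp only [dotProduct, Fintype.sum_prod_type, Fin.sum_univ_two, mon, dmon, det2] at h hp
  simp at h
  generalize e00 : p (0, 0) = p00 at *
  generalize e01 : p (0, 1) = p01 at *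
  generalize e10 : p (1, 0) = p10 at *
  generalize e11 : p (1, 1) = p11 at *
  generalize f00 : ℓ (0, 0) = l00 at *
  generalize f01 : ℓ (0, 1) = l01 at *
  generalize f10 : ℓ (1, 0) = l10 at *
  generalize f11 : ℓ (1, 1) = l11 at *
  -- `g0, g1, g2` are the coefficients in `t` of the resultant with respect to `s` of the two
  -- polynomials. The extra factor `p10 + t * p11` in `key` covers the values of `t` for which `s`
  -- cannot be solved for.
  obtain ⟨g0, hg0⟩ : ∃ g, g = l00 * p10 - l10 * p00 := ⟨_, rfl⟩
  obtain ⟨g1, hg1⟩ : ∃ g, g = l00 * p11 - l10 * p01 + l01 * p10 - l11 * p00 := ⟨_, rfl⟩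
  obtain ⟨g2, hg2⟩ : ∃ g, g = l01 * p11 - l11 * p01 := ⟨_, rfl⟩
  have key : ∀ t : ℂ, (p10 + t * p11) * (g0 + g1 * t + g2 * t ^ 2) = 0 := by
    intro t
    by_cases hD : p10 + t * p11 = 0
    · rw [hD, zero_mul]
    · have hs : ∃ s, s * (p10 + t * p11) = -(p00 + t * p01) := ⟨_, div_mul_cancel₀ _ hD⟩
      obtain ⟨s, hs⟩ := hs
      have := h s t hD (by linear_combination hs)
      rw [hg0, hg1, hg2]
      linear_combination (p10 + t * p11) ^ 2 * this - (p10 + t * p11) * (l10 + t * l11) * hs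
  -- A cubic in `t` is zero once it vanishes at four points.
  have k0 := key 0
  have k1 := key 1
  have k2 := key (-1)
  have k3 := key 2
  have c0 : p10 * g0 = 0 := by linear_combination k0
  have c2 : p10 * g2 + p11 * g1 = 0 := by linear_combination (k1 + k2) / 2 - k0
  have c3 : p11 * g2 = 0 := by linear_combination (k3 - 3 * k1 - k2 + 3 * k0) / 6
  have c1 : p10 * g1 + p11 * g0 = 0 := by linear_combination k1 - c0 - c2 - c3
  have hz : g0 = 0 ∧ g1 = 0 ∧ g2 = 0 := by
    by_cases h1 : p11 = 0
    · have h0 : p10 ≠ 0 := by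
        rintro rfl
        apply hp
        rw [h1]
        ring
      subst h1
      simp [h0] at c0 c1 c2
      exact ⟨c0, c1, c2⟩
    · have a2 : g2 = 0 := by simpa [h1] using c3
      subst a2
      have a1 : g1 = 0 := by simpa [h1] using c2
      subst a1
      have a0 : g0 = 0 := by simpa [h1] using c1
      exact ⟨a0, rfl, rfl⟩
  obtain ⟨z0, z1, z2⟩ := hz
  rw [z0] at hg0
  rw [z1] at hg1
  rw [z2] at hg2
  have hp' : p00 * p11 - p01 * p10 ≠ 0 := hp
  have e : ∀ I, ℓ I = (l00 * p11 - l10 * p01) / (p00 * p11 - p01 * p10) * p I := by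
    rintro ⟨i, j⟩
    rw [div_mul_eq_mul_div, eq_div_iff hp']
    fin_cases i <;> fin_cases j
    · simp only [Fin.zero_eta, e00, f00]
      linear_combination p01 * hg0
    · simp only [Fin.zero_eta, Fin.mk_one, e01, f01]
      linear_combination p01 * hg1 - p00 * hg2
    · simp only [Fin.zero_eta, Fin.mk_one, e10, f10]
      linear_combination p11 * hg0
    · simp only [Fin.mk_one, e11, f11]
      linear_combination p11 * hg1 - p10 * hg2
  exact ⟨_, funext e⟩

theorem dotProduct_mulVec_comm (M : Matrix (Fin 2 × Fin 2) (Fin 2 × Fin 2) ℂ)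
    (v w : Fin 2 × Fin 2 → ℂ) : v ⬝ᵥ M *ᵥ w = w ⬝ᵥ Mᵀ *ᵥ v := by
  rw [dotProduct_mulVec, ← mulVec_transpose, dotProduct_comm]

section Consistent

variable {A B C : Matrix (Fin 2 × Fin 2) (Fin 2 × Fin 2) ℂ}

/-- Consistency concerns points of two curves only. Applying the vanishing lemma in each pair in
turn extends it to all vectors orthogonal to the two equations. -/
theorem Consistent.dotProduct_eq_zero (h : Consistent A B C) {s t : ℂ}
    (hA : det2 (A *ᵥ mon s t) ≠ 0) (hB : det2 (Bᵀ *ᵥ mon s t) ≠ 0) {φ ψ : Fin 2 × Fin 2 → ℂ}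
    (hφ : φ ⬝ᵥ A *ᵥ mon s t = 0) (hψ : ψ ⬝ᵥ Bᵀ *ᵥ mon s t = 0) : φ ⬝ᵥ C *ᵥ ψ = 0 := by
  have h1 : ∀ z z', dmon z' ⬝ᵥ Bᵀ *ᵥ mon s t ≠ 0 → mon z z' ⬝ᵥ Bᵀ *ᵥ mon s t = 0 →
      φ ⬝ᵥ C *ᵥ mon z z' = 0 := by
    intro z z' hz hz'
    obtain ⟨c, hc⟩ := exists_eq_smul_of_vanishing (ℓ := C *ᵥ mon z z') hA fun x x' hx hx' =>
      h x x' s t z z' hx (by rwa [dotProduct_mulVec_comm]) hx' (by rwa [dotProduct_mulVec_comm])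
    rw [hc, dotProduct_smul, hφ, smul_zero]
  obtain ⟨c, hc⟩ := exists_eq_smul_of_vanishing (ℓ := Cᵀ *ᵥ φ) hB fun z z' hz hz' => by
    rw [← dotProduct_mulVec_comm]
    exact h1 z z' hz hz'
  rw [dotProduct_mulVec_comm, hc, dotProduct_smul, hψ, smul_zero]

theorem Consistent.transpose (h : Consistent A B C) : Consistent Bᵀ Aᵀ Cᵀ := by
  intro x x' y y' z z' h1 h2 h3 h4
  rw [← dotProduct_mulVec_comm] at h1 h2 h3 h4 ⊢
  exact h z z' y y' x x' h2 h1 h4 h3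

theorem eq_zero_of_generic {D₁ D₂ G : MvPolynomial (Fin 2) ℂ} (h₁ : D₁ ≠ 0) (h₂ : D₂ ≠ 0)
    (h : ∀ v, eval v D₁ ≠ 0 → eval v D₂ ≠ 0 → eval v G = 0) : G = 0 := by
  have : D₁ * D₂ * G = 0 := by
    refine MvPolynomial.funext fun v => ?_
    by_cases a : eval v D₁ = 0
    · simp [a]
    by_cases b : eval v D₂ = 0
    · simp [b]
    simp [h v a b]
  simpa [h₁, h₂] using this

theorem exists_generic {D₁ D₂ : MvPolynomial (Fin 2) ℂ} (h₁ : D₁ ≠ 0) (h₂ : D₂ ≠ 0) :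
    ∃ v, eval v D₁ ≠ 0 ∧ eval v D₂ ≠ 0 := by
  by_contra! h
  exact one_ne_zero (eq_zero_of_generic (G := 1) h₁ h₂ fun v a b => absurd (h v a) b)

/-- A matrix that kills the hyperplane orthogonal to `q` has all its rows proportional to `q`, hence
rank at most one. -/
theorem exists_dotProduct_eq_zero_mulVec_ne_zero (hC : ∀ a b, C ≠ vecMulVec a b)
    (q : Fin 2 × Fin 2 → ℂ) : ∃ ψ, ψ ⬝ᵥ q = 0 ∧ C *ᵥ ψ ≠ 0 := by
  by_contra! h
  by_cases hq : q = 0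
  · apply hC 0 0
    refine Matrix.ext_of_mulVec_single fun i => ?_
    rw [h _ (by simp [hq])]
    funext k
    simp
  · obtain ⟨i, hi⟩ := Function.ne_iff.1 hq
    apply hC ((q i)⁻¹ • C *ᵥ Pi.single i 1) q
    refine Matrix.ext_of_mulVec_single fun j => ?_
    have := h (Pi.single j 1 - (q j / q i) • Pi.single i 1) (by
      simp only [sub_dotProduct, smul_dotProduct, single_dotProduct, smul_eq_mul]
      field_simp [show q i ≠ 0 from hi]
      ring)
    rw [mulVec_sub, mulVec_smul, sub_eq_zero] at this
    rw [this]
    funext k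
    simp [vecMulVec_apply]
    field_simp

/-- `C` maps the hyperplane orthogonal to `Bᵀ *ᵥ mon s t` into the line through `A *ᵥ mon s t`, and
not to zero since `C` is not of rank one. So that line lies in the range, and one vector off the
hyperplane supplies the rest of it. -/
theorem Consistent.mulVec_mon_mem_range (h : Consistent A B C) (hC : ∀ a b, C ≠ vecMulVec a b)
    {s t : ℂ} (hA : det2 (A *ᵥ mon s t) ≠ 0) (hB : det2 (Bᵀ *ᵥ mon s t) ≠ 0) :
    A *ᵥ mon s t ∈ LinearMap.range C.mulVecLin ∧
      Module.finrank ℂ (LinearMap.range C.mulVecLin) ≤ 2 := by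
  have hspan : ∀ ψ, ψ ⬝ᵥ Bᵀ *ᵥ mon s t = 0 → ∃ c : ℂ, C *ᵥ ψ = c • A *ᵥ mon s t := fun ψ hψ =>
    exists_eq_smul_of_vanishing hA fun x x' _ hx' => h.dotProduct_eq_zero hA hB hx' hψ
  constructor
  · obtain ⟨ψ, hψ, hne⟩ := exists_dotProduct_eq_zero_mulVec_ne_zero hC (Bᵀ *ᵥ mon s t)
    obtain ⟨c, hc⟩ := hspan ψ hψ
    have hc0 : c ≠ 0 := by
      rintro rfl
      exact hne (by rw [hc, zero_smul])
    refine ⟨c⁻¹ • ψ, ?_⟩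
    rw [map_smul, mulVecLin_apply, hc, smul_smul, inv_mul_cancel₀ hc0, one_smul]
  · set q := Bᵀ *ᵥ mon s t with hq
    have hq0 : q ≠ 0 := by
      intro h0
      rw [h0] at hB
      simp [det2] at hB
    obtain ⟨i, hi⟩ := Function.ne_iff.1 hq0
    have hle : LinearMap.range C.mulVecLin ≤
        Submodule.span ℂ ({A *ᵥ mon s t, C *ᵥ Pi.single i 1} : Finset (Fin 2 × Fin 2 → ℂ)) := by
      rintro _ ⟨ψ, rfl⟩
      obtain ⟨c, hc⟩ := hspan (ψ - (ψ ⬝ᵥ q / q i) • Pi.single i 1) (by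
        simp only [sub_dotProduct, smul_dotProduct, single_dotProduct, smul_eq_mul]
        field_simp [show q i ≠ 0 from hi]
        ring)
      rw [mulVec_sub, mulVec_smul, sub_eq_iff_eq_add] at hc
      rw [mulVecLin_apply, hc]
      refine Submodule.add_mem _ (Submodule.smul_mem _ _ (Submodule.subset_span (by simp)))
        (Submodule.smul_mem _ _ (Submodule.subset_span (by simp)))
    exact (Submodule.finrank_mono hle).trans
      ((finrank_span_finset_le_card _).trans Finset.card_le_two)

/-- A functional vanishing on `V` gives a polynomial in `s, t` that is zero generically, hence
identically: generic monomial vectors span everything. -/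
theorem range_le_of_generic {D₁ D₂ : MvPolynomial (Fin 2) ℂ} (h₁ : D₁ ≠ 0) (h₂ : D₂ ≠ 0)
    {V : Submodule ℂ (Fin 2 × Fin 2 → ℂ)}
    (h : ∀ v, eval v D₁ ≠ 0 → eval v D₂ ≠ 0 → A *ᵥ mon (v 0) (v 1) ∈ V) :
    LinearMap.range A.mulVecLin ≤ V := by
  rintro _ ⟨w, rfl⟩
  by_contra hw
  obtain ⟨f, hf, hV⟩ := Submodule.exists_le_ker_of_notMem hw
  obtain ⟨a, rfl⟩ : ∃ a, dotProductEquiv ℂ (Fin 2 × Fin 2) a = f :=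
    (dotProductEquiv ℂ (Fin 2 × Fin 2)).surjective f
  have h0 : linPoly (Aᵀ *ᵥ a) = 0 := eq_zero_of_generic h₁ h₂ fun v hv hv' => by
    rw [eval_linPoly, dotProduct_comm, ← dotProduct_mulVec_comm]
    exact hV (h v hv hv')
  apply hf
  change a ⬝ᵥ A *ᵥ w = 0
  rw [dotProduct_mulVec_comm, linPoly_eq_zero h0, dotProduct_zero]

theorem Consistent.range_le (h : Consistent A B C) (hC : ∀ a b, C ≠ vecMulVec a b)
    (hA : detPoly A ≠ 0) (hB : detPoly Bᵀ ≠ 0) :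
    LinearMap.range A.mulVecLin ≤ LinearMap.range C.mulVecLin ∧
      Module.finrank ℂ (LinearMap.range C.mulVecLin) ≤ 2 := by
  constructor
  · refine range_le_of_generic hA hB fun v hv hv' => ?_
    rw [eval_detPoly] at hv hv'
    exact (h.mulVec_mon_mem_range hC hv hv').1
  · obtain ⟨v, hv, hv'⟩ := exists_generic hA hB
    rw [eval_detPoly] at hv hv'
    exact (h.mulVec_mon_mem_range hC hv hv').2

end Consistent

/-! ### Normal forms of pencils -/

theorem exists_quadratic_root {a : ℂ} (ha : a ≠ 0) (b c : ℂ) : ∃ x, a * (x * x) + b * x + c = 0 :=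
  exists_quadratic_eq_zero ha (IsAlgClosed.exists_eq_mul_self _)

/-- A binary quadratic form over `ℂ` is a product of linear forms. -/
theorem exists_quadratic_form_factor (a b c : ℂ) :
    ∃ p q r s : ℂ, a = p * r ∧ b = p * s + q * r ∧ c = q * s := by
  by_cases ha : a = 0
  · exact ⟨0, 1, b, c, by simp [ha], by simp, by simp⟩
  · obtain ⟨x, hx⟩ := exists_quadratic_root ha b c
    exact ⟨1, -x, a, b + a * x, by ring, by ring, by linear_combination hx⟩

theorem exists_eq_mul_of_det2_eq_zero {P : Fin 2 × Fin 2 → ℂ} (hP : P ≠ 0) (hdet : det2 P = 0) :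
    ∃ a b : Fin 2 → ℂ, a ≠ 0 ∧ b ≠ 0 ∧ ∀ I, P I = a I.1 * b I.2 := by
  obtain ⟨⟨i, j⟩, hij⟩ := Function.ne_iff.1 hP
  rw [Pi.zero_apply] at hij
  refine ⟨fun k => P (k, j), fun l => P (i, l) / P (i, j), fun h => hij (congrFun h i), fun h => ?_,
    ?_⟩
  · have := congrFun h j
    simp [hij] at this
  · rintro ⟨k, l⟩
    simp only [det2] at hdet
    rw [mul_div_assoc', eq_div_iff hij]
    fin_cases i <;> fin_cases j <;> fin_cases k <;> fin_cases l <;>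
      simp only [Fin.zero_eta, Fin.mk_one] <;> first | ring1 | linear_combination hdet |
        linear_combination -hdet

theorem exists_complement {a : Fin 2 → ℂ} (ha : a ≠ 0) :
    ∃ c : Fin 2 → ℂ, a 0 * c 1 - a 1 * c 0 ≠ 0 := by
  by_cases h : a 0 = 0
  · refine ⟨![1, 0], fun h1 => ha ?_⟩
    simp at h1
    funext i
    fin_cases i <;> simp [h, h1]
  · exact ⟨![0, 1], by simpa using h⟩

theorem exists_coordinates {R R' : Matrix (Fin 2) (Fin 2) ℂ} (hR : R.det ≠ 0) (hR' : R'.det ≠ 0)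
    (G : Fin 2 × Fin 2 → ℂ) :
    ∃ n : Matrix (Fin 2) (Fin 2) ℂ, ∀ I, G I =
      n 0 0 * (R 0 I.1 * R' 0 I.2) + n 0 1 * (R 0 I.1 * R' 1 I.2) +
      n 1 0 * (R 1 I.1 * R' 0 I.2) + n 1 1 * (R 1 I.1 * R' 1 I.2) := by
  let M : Matrix (Fin 2) (Fin 2) ℂ := of fun i j => G (i, j)
  refine ⟨Rᵀ⁻¹ * M * R'⁻¹, fun ⟨i, j⟩ => ?_⟩
  have hM : M = Rᵀ * (Rᵀ⁻¹ * M * R'⁻¹) * R' := by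
    have h1 : Rᵀ * Rᵀ⁻¹ = 1 := mul_nonsing_inv _ (by simpa using hR)
    have h2 : R'⁻¹ * R' = 1 := nonsing_inv_mul _ (by simpa using hR')
    rw [Matrix.mul_assoc, Matrix.mul_assoc _ _ R', h2, Matrix.mul_one, ← Matrix.mul_assoc, h1,
      Matrix.one_mul]
  generalize Rᵀ⁻¹ * M * R'⁻¹ = n at hM
  change M i j = _
  rw [hM]
  simp only [mul_apply, Fin.sum_univ_two, transpose_apply]
  ring

/-- A pencil of `2 × 2` matrices that is not identically singular is, in suitable bases, spanned
either by two matrix units `E₁₀`, `E₀₁` or by `E₁₀ + E₀₁` and `E₀₀`. -/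
theorem exists_pencil_basis {V : Submodule ℂ (Fin 2 × Fin 2 → ℂ)} (hV : 2 ≤ Module.finrank ℂ V)
    {G : Fin 2 × Fin 2 → ℂ} (hG : G ∈ V) (hdet : det2 G ≠ 0) :
    ∃ R R' : Matrix (Fin 2) (Fin 2) ℂ, R.det ≠ 0 ∧ R'.det ≠ 0 ∧
      (((fun I => R 1 I.1 * R' 0 I.2) ∈ V ∧ (fun I => R 0 I.1 * R' 1 I.2) ∈ V) ∨
       ((fun I => R 1 I.1 * R' 0 I.2 + R 0 I.1 * R' 1 I.2) ∈ V ∧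
        (fun I => R 0 I.1 * R' 0 I.2) ∈ V)) := by
  obtain ⟨H, hH, hHG⟩ : ∃ H ∈ V, H ∉ Submodule.span ℂ {G} := by
    by_contra! h
    have h1 := Submodule.finrank_mono (show V ≤ Submodule.span ℂ {G} from h)
    have h2 := finrank_span_le_card (R := ℂ) ({G} : Set (Fin 2 × Fin 2 → ℂ))
    simp at h2
    omega
  -- `det2 (H + x • G)` is quadratic in `x` with leading coefficient `det2 G`, so the pencil
  -- contains a rank-one element `P = a ⊗ b`.
  obtain ⟨x, hx⟩ := exists_quadratic_root hdet
    (H (0, 0) * G (1, 1) + G (0, 0) * H (1, 1) - H (0, 1) * G (1, 0) - G (0, 1) * H (1, 0)) (det2 H)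
  have hPV : H + x • G ∈ V := V.add_mem hH (V.smul_mem _ hG)
  have hP0 : H + x • G ≠ 0 := fun h => hHG (by
    rw [eq_neg_of_add_eq_zero_left h]
    exact Submodule.neg_mem _ (Submodule.smul_mem _ _ (Submodule.mem_span_singleton_self G)))
  have hPdet : det2 (H + x • G) = 0 := by
    simp only [det2, Pi.add_apply, Pi.smul_apply, smul_eq_mul] at hx ⊢
    linear_combination hx
  generalize H + x • G = P at hPV hP0 hPdet
  obtain ⟨a, b, ha, hb, hP⟩ := exists_eq_mul_of_det2_eq_zero hP0 hPdet
  obtain ⟨c, hc⟩ := exists_complement ha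
  obtain ⟨d, hd⟩ := exists_complement hb
  obtain ⟨n, hn⟩ := exists_coordinates (R := of ![a, c]) (R' := of ![b, d])
    (by simpa [det_fin_two] using hc) (by simpa [det_fin_two] using hd) G
  simp only [of_apply, cons_val_zero, cons_val_one] at hn
  -- In the bases `a, c` and `b, d`, the determinant of `G + λ P` is affine in `λ` with slope `n 1
  -- 1`. If the slope is zero, `P` is the only rank-one direction; otherwise there is a second one.
  by_cases h11 : n 1 1 = 0
  · have hnn : n 0 1 ≠ 0 ∧ n 1 0 ≠ 0 := by
      constructor <;> intro h0 <;> apply hdet <;> simp only [det2, hn, h11, h0] <;> ring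
    refine ⟨of ![a, n 1 0 • c], of ![b, n 0 1 • d], ?_, ?_, Or.inr ⟨?_, ?_⟩⟩
    · simp only [det_fin_two, of_apply, cons_val_zero, cons_val_one, Pi.smul_apply, smul_eq_mul]
      intro h0
      exact mul_ne_zero hnn.2 hc (by linear_combination h0)
    · simp only [det_fin_two, of_apply, cons_val_zero, cons_val_one, Pi.smul_apply, smul_eq_mul]
      intro h0
      exact mul_ne_zero hnn.1 hd (by linear_combination h0)
    · convert V.sub_mem hG (V.smul_mem (n 0 0) hPV) using 1
      funext I
      simp [hn, hP, h11]
      ring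
    · convert hPV using 1
      funext I
      simp [hP]
  · refine ⟨of ![n 0 1 • a + n 1 1 • c, a], of ![b, (n 1 0 / n 1 1) • b + d], ?_, ?_,
      Or.inl ⟨?_, ?_⟩⟩
    · simp only [det_fin_two, of_apply, cons_val_zero, cons_val_one, Pi.add_apply, Pi.smul_apply,
        smul_eq_mul]
      intro h0
      exact mul_ne_zero h11 hc (by linear_combination -h0)
    · simp only [det_fin_two, of_apply, cons_val_zero, cons_val_one, Pi.add_apply, Pi.smul_apply,
        smul_eq_mul]
      intro h0
      exact hd (by linear_combination h0)
    · convert hPV using 1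
      funext I
      simp [hP]
    -- The coefficient of `P` is the root `λ` of that affine determinant.
    · convert V.add_mem hG (V.smul_mem (n 0 1 * n 1 0 / n 1 1 - n 0 0) hPV) using 1
      funext I
      simp [hn, hP]
      field_simp
      ring

/-- Denominator and numerator of the Möbius transformation with matrix `r`, as linear polynomials
in `x`. -/
noncomputable def homog (r : Matrix (Fin 2) (Fin 2) ℂ) (x : MvPolynomial (Fin 6) ℂ) :
    Fin 2 → MvPolynomial (Fin 6) ℂ :=
  ![C (r 1 0) * x + C (r 1 1), C (r 0 0) * x + C (r 0 1)]

/-- The two generators of a pencil in normal form. -/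
noncomputable def normal (T : Bool) (x z : MvPolynomial (Fin 6) ℂ) :
    Fin 2 → MvPolynomial (Fin 6) ℂ :=
  if T then ![x + z, 1] else ![x, z]

theorem exists_homog_inverse {R : Matrix (Fin 2) (Fin 2) ℂ} (hR : R.det ≠ 0) :
    ∃ r : Matrix (Fin 2) (Fin 2) ℂ, r.det ≠ 0 ∧ ∀ x,
      C (R 0 0) * homog r x 0 + C (R 0 1) * homog r x 1 = 1 ∧
      C (R 1 0) * homog r x 0 + C (R 1 1) * homog r x 1 = x := by
  rw [det_fin_two] at hR
  set Δ := R 0 0 * R 1 1 - R 0 1 * R 1 0 with hΔ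
  -- These are the entries of `R⁻¹`, rearranged because `homog` lists the denominator first and `R`
  -- acts on `(1, x)`.
  refine ⟨!![R 0 0 / Δ, -R 1 0 / Δ; -R 0 1 / Δ, R 1 1 / Δ], ?_, fun x => ?_⟩
  · rw [det_fin_two_of]
    have : R 0 0 / Δ * (R 1 1 / Δ) - -R 1 0 / Δ * (-R 0 1 / Δ) = Δ⁻¹ := by
      field_simp
      rw [hΔ]
      ring
    rw [this]
    exact inv_ne_zero hR
  · have e1 : R 0 0 * (R 1 1 / Δ) + R 0 1 * (-R 1 0 / Δ) = 1 := by
      field_simp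
      rw [hΔ]
      ring
    have e2 : R 1 0 * (-R 0 1 / Δ) + R 1 1 * (R 0 0 / Δ) = 1 := by
      field_simp
      rw [hΔ]
      ring
    have e3 : R 0 0 * (-R 0 1 / Δ) + R 0 1 * (R 0 0 / Δ) = 0 := by ring
    have e4 : R 1 0 * (R 1 1 / Δ) + R 1 1 * (-R 1 0 / Δ) = 0 := by ring
    have f1 := congrArg (C (σ := Fin 6)) e1
    have f2 := congrArg (C (σ := Fin 6)) e2
    have f3 := congrArg (C (σ := Fin 6)) e3
    have f4 := congrArg (C (σ := Fin 6)) e4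
    simp only [map_add, map_mul, map_one, map_zero] at f1 f2 f3 f4
    simp only [homog, of_apply, cons_val', cons_val_zero, cons_val_one, cons_val_fin_one]
    constructor
    · linear_combination f1 + x * f3
    · linear_combination x * f2 + f4

/-- Inverting the basis changes turns row 0 of each basis matrix into `1` and row 1 into the
variable, so the two kinds of pencil become `x, z` and `x + z, 1`. -/
theorem exists_normal_form {V : Submodule ℂ (Fin 2 × Fin 2 → ℂ)} (hV : 2 ≤ Module.finrank ℂ V)
    {G : Fin 2 × Fin 2 → ℂ} (hG : G ∈ V) (hdet : det2 G ≠ 0) :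
    ∃ r r' : Matrix (Fin 2) (Fin 2) ℂ, r.det ≠ 0 ∧ r'.det ≠ 0 ∧ ∃ (T : Bool)
      (P : Matrix (Fin 2 × Fin 2) (Fin 2) ℂ), (∀ b, P.col b ∈ V) ∧
        ∀ x z b, ∑ I, C (P I b) * (homog r x I.1 * homog r' z I.2) = normal T x z b := by
  obtain ⟨R, R', hR, hR', h⟩ := exists_pencil_basis hV hG hdet
  obtain ⟨r, hr, hrx⟩ := exists_homog_inverse hR
  obtain ⟨r', hr', hrz⟩ := exists_homog_inverse hR'
  refine ⟨r, r', hr, hr', ?_⟩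
  rcases h with ⟨h0, h1⟩ | ⟨h0, h1⟩
  · refine ⟨false, of fun I => ![R 1 I.1 * R' 0 I.2, R 0 I.1 * R' 1 I.2], ?_, fun x z b => ?_⟩
    · intro b
      fin_cases b
      exacts [h0, h1]
    · obtain ⟨hx0, hx1⟩ := hrx x
      obtain ⟨hz0, hz1⟩ := hrz z
      generalize homog r x = ξ at *
      generalize homog r' z = ζ at *
      fin_cases b <;>
        simp only [Fin.zero_eta, Fin.mk_one, of_apply, cons_val_zero, cons_val_one, normal,
          Fintype.sum_prod_type, Fin.sum_univ_two, map_mul, Bool.false_eq_true, if_false]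
      · rw [← hx1]
        linear_combination (C (R 1 0) * ξ 0 + C (R 1 1) * ξ 1) * hz0
      · rw [← hz1]
        linear_combination (C (R' 1 0) * ζ 0 + C (R' 1 1) * ζ 1) * hx0
  · refine ⟨true, of fun I => ![R 1 I.1 * R' 0 I.2 + R 0 I.1 * R' 1 I.2, R 0 I.1 * R' 0 I.2], ?_,
      fun x z b => ?_⟩
    · intro b
      fin_cases b
      exacts [h0, h1]
    · obtain ⟨hx0, hx1⟩ := hrx x
      obtain ⟨hz0, hz1⟩ := hrz z
      generalize homog r x = ξ at *
      generalize homog r' z = ζ at *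
      fin_cases b <;>
        simp only [Fin.zero_eta, Fin.mk_one, of_apply, cons_val_zero, cons_val_one, normal,
          Fintype.sum_prod_type, Fin.sum_univ_two, map_mul, map_add, if_true]
      · rw [← hz1, ← hx1]
        linear_combination (C (R' 1 0) * ζ 0 + C (R' 1 1) * ζ 1) * hx0 +
          (C (R 1 0) * ξ 0 + C (R 1 1) * ξ 1) * hz0
      · linear_combination (C (R' 0 0) * ζ 0 + C (R' 0 1) * ζ 1) * hx0 + hz0

/-! ### Reduction to 2×2 matrices -/

theorem exists_leftInverse_of_normal {r r' : Matrix (Fin 2) (Fin 2) ℂ} {T : Bool}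
    {P : Matrix (Fin 2 × Fin 2) (Fin 2) ℂ}
    (h : ∀ x z b, ∑ I, C (P I b) * (homog r x I.1 * homog r' z I.2) = normal T x z b) :
    ∃ L : Matrix (Fin 2) (Fin 2 × Fin 2) ℂ, L * P = 1 := by
  have hinj : LinearMap.ker P.mulVecLin = ⊥ := by
    rw [LinearMap.ker_eq_bot']
    intro c hc
    have key : ∀ x z, C (c 0) * normal T x z 0 + C (c 1) * normal T x z 1 = 0 := by
      intro x z
      rw [← h, ← h, Finset.mul_sum, Finset.mul_sum, ← Finset.sum_add_distrib]
      refine Finset.sum_eq_zero fun I _ => ?_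
      have hI : P I 0 * c 0 + P I 1 * c 1 = 0 := by
        simpa [mulVec, dotProduct] using congrFun hc I
      have hC := congrArg (C (σ := Fin 6)) hI
      simp only [map_add, map_mul, map_zero] at hC
      linear_combination (homog r x I.1 * homog r' z I.2) * hC
    have k1 := key 1 0
    have k2 := key 0 1
    have k3 := key 0 0
    have hc' : c 0 = 0 ∧ c 1 = 0 := by
      cases T <;> simp [normal] at k1 k2 k3
      · exact ⟨k1, k2⟩
      · rw [k3] at k1
        exact ⟨by simpa using k1, k3⟩
    funext i
    fin_cases i
    exacts [hc'.1, hc'.2]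
  obtain ⟨g, hg⟩ := P.mulVecLin.exists_leftInverse_of_injective hinj
  refine ⟨LinearMap.toMatrix' g, ?_⟩
  have := congrArg LinearMap.toMatrix' hg
  rwa [LinearMap.toMatrix'_comp, ← toLin'_apply', LinearMap.toMatrix'_toLin',
    LinearMap.toMatrix'_id] at this

theorem mulVec_leftInverse_eq {V : Submodule ℂ (Fin 2 × Fin 2 → ℂ)}
    (hV : Module.finrank ℂ V ≤ 2) {P : Matrix (Fin 2 × Fin 2) (Fin 2) ℂ}
    {L : Matrix (Fin 2) (Fin 2 × Fin 2) ℂ} (hL : L * P = 1) (hP : ∀ b, P.col b ∈ V)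
    {v : Fin 2 × Fin 2 → ℂ} (hv : v ∈ V) : P *ᵥ L *ᵥ v = v := by
  have hinj : Function.Injective P.mulVecLin := fun a b hab => by
    have := congrArg (L *ᵥ ·) hab
    simpa [hL] using this
  have hle : LinearMap.range P.mulVecLin ≤ V := by
    rw [range_mulVecLin, Submodule.span_le]
    rintro _ ⟨b, rfl⟩
    exact hP b
  have heq : LinearMap.range P.mulVecLin = V := by
    refine Submodule.eq_of_le_of_finrank_le hle ?_
    rw [LinearMap.finrank_range_of_inj hinj]
    simpa using hV
  rw [← heq] at hv
  obtain ⟨w, rfl⟩ := hv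
  rw [mulVecLin_apply, mulVec_mulVec w L P, hL, one_mulVec]

/-- `P * L` fixes the columns of `M` and `R * K` fixes its rows. -/
theorem eq_mul_mul_transpose {M : Matrix (Fin 2 × Fin 2) (Fin 2 × Fin 2) ℂ}
    {P R : Matrix (Fin 2 × Fin 2) (Fin 2) ℂ} {L K : Matrix (Fin 2) (Fin 2 × Fin 2) ℂ}
    (hP : ∀ v ∈ LinearMap.range M.mulVecLin, P *ᵥ L *ᵥ v = v)
    (hR : ∀ v ∈ LinearMap.range Mᵀ.mulVecLin, R *ᵥ K *ᵥ v = v) :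
    M = P * (L * M * Kᵀ) * Rᵀ := by
  have h1 : P * L * M = M := Matrix.ext_of_mulVec_single fun i => by
    rw [← mulVec_mulVec, ← mulVec_mulVec]
    exact hP _ ⟨_, rfl⟩
  have h2 : R * K * Mᵀ = Mᵀ := Matrix.ext_of_mulVec_single fun i => by
    rw [← mulVec_mulVec, ← mulVec_mulVec]
    exact hR _ ⟨_, rfl⟩
  have h3 : M * Kᵀ * Rᵀ = M := by
    have := congrArg Matrix.transpose h2
    simpa [Matrix.mul_assoc] using this
  calc M = P * L * (M * Kᵀ * Rᵀ) := by rw [h3, h1]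
    _ = _ := by simp only [Matrix.mul_assoc]

theorem det_ne_zero_of_ne_vecMulVec {M : Matrix (Fin 2 × Fin 2) (Fin 2 × Fin 2) ℂ}
    (hM : ∀ a b, M ≠ vecMulVec a b) {P R : Matrix (Fin 2 × Fin 2) (Fin 2) ℂ}
    {A : Matrix (Fin 2) (Fin 2) ℂ} (h : M = P * A * Rᵀ) : A.det ≠ 0 := by
  intro hdet
  have hA : ∃ a b, A = vecMulVec a b := by
    by_cases h0 : A = 0
    · exact ⟨0, 0, by simp [h0]⟩
    · obtain ⟨a, b, -, -, hab⟩ := exists_eq_mul_of_det2_eq_zero (P := fun I => A I.1 I.2)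
        (fun h1 => h0 (by ext i j; exact congrFun h1 (i, j))) (by
          rw [det_fin_two] at hdet
          simpa [det2] using hdet)
      exact ⟨a, b, by ext i j; exact hab (i, j)⟩
  obtain ⟨a, b, rfl⟩ := hA
  refine hM (P *ᵥ a) (b ᵥ* Rᵀ) ?_
  rw [h, mul_vecMulVec, vecMulVec_mul]

/-- With `J = !![0, 1; -1, 0]`, the hypothesis says that `(J A)ᵀ D (J Bᵀ)` is skew, hence a multiple
of `J`; solving for `D` gives a multiple of `A J B`. -/
theorem eq_smul_mul_of_form_eq_zero {A B D : Matrix (Fin 2) (Fin 2) ℂ} (hA : A.det ≠ 0)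
    (hB : B.det ≠ 0) (hD : D ≠ 0)
    (h : ∀ ρ : Fin 2 → ℂ, ![(A *ᵥ ρ) 1, -(A *ᵥ ρ) 0] ⬝ᵥ D *ᵥ ![(Bᵀ *ᵥ ρ) 1, -(Bᵀ *ᵥ ρ) 0] = 0) :
    ∃ k : ℂ, k ≠ 0 ∧ D = k • (A * !![0, 1; -1, 0] * B) := by
  have h0 := h ![1, 0]
  have h1 := h ![0, 1]
  have h2 := h ![1, 1]
  simp [dotProduct, mulVec, Fin.sum_univ_two] at h0 h1 h2
  rw [det_fin_two] at hA hB
  -- `w` is the upper right entry of that skew matrix.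
  obtain ⟨w, hw⟩ : ∃ w, w = A 1 0 * (D 0 0 * B 1 1 - D 0 1 * B 1 0) -
    A 0 0 * (D 1 0 * B 1 1 - D 1 1 * B 1 0) := ⟨_, rfl⟩
  have hAB := mul_ne_zero hA hB
  have key : D = (w / ((A 0 0 * A 1 1 - A 0 1 * A 1 0) * (B 0 0 * B 1 1 - B 0 1 * B 1 0))) •
      (A * !![0, 1; -1, 0] * B) := by
    ext i j
    rw [Matrix.smul_apply, smul_eq_mul, div_mul_eq_mul_div, eq_div_iff hAB]
    simp only [mul_apply, Fin.sum_univ_two]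
    fin_cases i <;> fin_cases j <;> simp [hw]
    · linear_combination A 0 1 * B 1 0 * h0 - A 0 0 * B 1 0 * (h2 - h0 - h1) + A 0 0 * B 0 0 * h1
    · linear_combination A 0 1 * B 1 1 * h0 - A 0 0 * B 1 1 * (h2 - h0 - h1) + A 0 0 * B 0 1 * h1
    · linear_combination A 1 1 * B 1 0 * h0 - A 1 0 * B 1 0 * (h2 - h0 - h1) + A 1 0 * B 0 0 * h1
    · linear_combination A 1 1 * B 1 1 * h0 - A 1 0 * B 1 1 * (h2 - h0 - h1) + A 1 0 * B 0 1 * h1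
  refine ⟨_, fun hk => hD ?_, key⟩
  rw [key, hk, zero_smul]

/-- The vectors `Rᵀ *ᵥ mon s t` satisfy the quadratic relation `F = 0` generically, but it is needed
for every `ρ`. Factoring `F` into linear forms makes it a product of two polynomials in `s, t`; one
of them is zero, and independence of the columns of `R` kills the corresponding linear form. -/
theorem Consistent.exists_eq_smul {M₁ M₂ M₃ : Matrix (Fin 2 × Fin 2) (Fin 2 × Fin 2) ℂ}
    (h : Consistent M₁ M₂ M₃) (hd₁ : detPoly M₁ ≠ 0) (hd₂ : detPoly M₂ᵀ ≠ 0)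
    {P R T : Matrix (Fin 2 × Fin 2) (Fin 2) ℂ} {L K N : Matrix (Fin 2) (Fin 2 × Fin 2) ℂ}
    {A B D : Matrix (Fin 2) (Fin 2) ℂ} (hL : L * P = 1) (hK : K * R = 1) (hN : N * T = 1)
    (h₁ : M₁ = P * A * Rᵀ) (h₂ : M₂ = R * B * Tᵀ) (h₃ : M₃ = P * D * Tᵀ)
    (hA : A.det ≠ 0) (hB : B.det ≠ 0) (hD : D ≠ 0) :
    ∃ k : ℂ, k ≠ 0 ∧ D = k • (A * !![0, 1; -1, 0] * B) := by
  have hval : ∀ s t, det2 (M₁ *ᵥ mon s t) ≠ 0 → det2 (M₂ᵀ *ᵥ mon s t) ≠ 0 →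
      ∀ α β : Fin 2 → ℂ, α ⬝ᵥ A *ᵥ Rᵀ *ᵥ mon s t = 0 → β ⬝ᵥ Bᵀ *ᵥ Rᵀ *ᵥ mon s t = 0 →
        α ⬝ᵥ D *ᵥ β = 0 := by
    intro s t e₁ e₂ α β hα hβ
    have := h.dotProduct_eq_zero e₁ e₂ (φ := Lᵀ *ᵥ α) (ψ := Nᵀ *ᵥ β) ?_ ?_
    · rw [mulVec_transpose, ← dotProduct_mulVec, h₃, mulVec_mulVec, mulVec_mulVec] at this
      have e : L * (P * D * Tᵀ) * Nᵀ = D := by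
        rw [Matrix.mul_assoc L, Matrix.mul_assoc (P * D), ← transpose_mul, hN, transpose_one, Matrix.mul_one,
          ← Matrix.mul_assoc, hL, Matrix.one_mul]
      rwa [e] at this
    · rw [mulVec_transpose, ← dotProduct_mulVec, h₁, mulVec_mulVec]
      have e : L * (P * A * Rᵀ) = A * Rᵀ := by
        rw [← Matrix.mul_assoc, ← Matrix.mul_assoc, hL, Matrix.one_mul]
      rwa [e, ← mulVec_mulVec]
    · rw [mulVec_transpose, ← dotProduct_mulVec, h₂, mulVec_mulVec]
      have e : N * (R * B * Tᵀ)ᵀ = Bᵀ * Rᵀ := by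
        rw [transpose_mul, transpose_mul, transpose_transpose, ← Matrix.mul_assoc, hN,
          Matrix.one_mul]
      rwa [e, ← mulVec_mulVec]
  refine eq_smul_mul_of_form_eq_zero hA hB hD ?_
  set F : (Fin 2 → ℂ) → ℂ := fun ρ =>
    ![(A *ᵥ ρ) 1, -(A *ᵥ ρ) 0] ⬝ᵥ D *ᵥ ![(Bᵀ *ᵥ ρ) 1, -(Bᵀ *ᵥ ρ) 0] with hF
  obtain ⟨a, b, c, hform⟩ : ∃ a b c : ℂ, ∀ ρ, F ρ = a * ρ 0 ^ 2 + b * (ρ 0 * ρ 1) + c * ρ 1 ^ 2 := by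
    refine ⟨F ![1, 0], F ![1, 1] - F ![1, 0] - F ![0, 1], F ![0, 1], fun ρ => ?_⟩
    simp [hF, dotProduct, mulVec, Fin.sum_univ_two]
    ring
  obtain ⟨p, q, r, s, rfl, rfl, rfl⟩ := exists_quadratic_form_factor a b c
  have hzero : linPoly (p • R.col 0 + q • R.col 1) * linPoly (r • R.col 0 + s • R.col 1) = 0 := by
    refine eq_zero_of_generic hd₁ hd₂ fun v hv hv' => ?_
    rw [eval_detPoly] at hv hv'
    have e := hval _ _ hv hv' ![(A *ᵥ Rᵀ *ᵥ mon (v 0) (v 1)) 1, -(A *ᵥ Rᵀ *ᵥ mon (v 0) (v 1)) 0]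
      ![(Bᵀ *ᵥ Rᵀ *ᵥ mon (v 0) (v 1)) 1, -(Bᵀ *ᵥ Rᵀ *ᵥ mon (v 0) (v 1)) 0]
      (by simp [dotProduct, Fin.sum_univ_two]; ring) (by simp [dotProduct, Fin.sum_univ_two]; ring)
    have e' : F (Rᵀ *ᵥ mon (v 0) (v 1)) = 0 := e
    rw [hform] at e'
    have hcol : ∀ b, R.col b ⬝ᵥ mon (v 0) (v 1) = (Rᵀ *ᵥ mon (v 0) (v 1)) b := fun b => rfl
    simp only [map_mul, eval_linPoly, add_dotProduct, smul_dotProduct, smul_eq_mul, hcol]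
    linear_combination e'
  have hind : ∀ p q : ℂ, p • R.col 0 + q • R.col 1 = 0 → p = 0 ∧ q = 0 := by
    intro p q hpq
    have hR : R *ᵥ ![p, q] = 0 := by
      rw [← hpq]
      funext I
      simp [mulVec, dotProduct, Fin.sum_univ_two, mul_comm]
    have h0 : (![p, q] : Fin 2 → ℂ) = 0 := by
      rw [← one_mulVec ![p, q], ← hK, ← mulVec_mulVec, hR, mulVec_zero]
    exact ⟨congrFun h0 0, congrFun h0 1⟩
  intro ρ
  change F ρ = 0
  rw [hform]
  rcases mul_eq_zero.1 hzero with h0 | h0 <;> obtain ⟨rfl, rfl⟩ := hind _ _ (linPoly_eq_zero h0) <;>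
    ring

theorem two_le_finrank_range {M : Matrix (Fin 2 × Fin 2) (Fin 2 × Fin 2) ℂ}
    (hM : ∀ a b, M ≠ vecMulVec a b) : 2 ≤ Module.finrank ℂ (LinearMap.range M.mulVecLin) := by
  by_contra! hlt
  obtain ⟨v, hv⟩ := finrank_le_one_iff.1 (Nat.le_of_lt_succ hlt)
  choose c hc using fun j => hv ⟨_, LinearMap.mem_range_self M.mulVecLin (Pi.single j 1)⟩
  refine hM v c (Matrix.ext_of_mulVec_single fun j => ?_)
  have := congrArg Subtype.val (hc j)
  simp only [Submodule.coe_smul, mulVecLin_apply] at this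
  rw [← this]
  funext I
  simp [vecMulVec_apply, mul_comm]

/-- A pair of opposite variables together with Möbius transformations bringing the pencil with
generators `P` to normal form. -/
structure NormalPair (P : Matrix (Fin 2 × Fin 2) (Fin 2) ℂ) where
  /-- the transformation of the first variable -/
  r : Matrix (Fin 2) (Fin 2) ℂ
  /-- the transformation of the second variable -/
  r' : Matrix (Fin 2) (Fin 2) ℂ
  /-- the type of the normal form -/
  T : Bool
  det_ne_zero : r.det ≠ 0
  det_ne_zero' : r'.det ≠ 0
  sum_eq : ∀ x z b, ∑ I, C (P I b) * (homog r x I.1 * homog r' z I.2) = normal T x z b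

theorem exists_frame {V : Submodule ℂ (Fin 2 × Fin 2 → ℂ)}
    (hV : 2 ≤ Module.finrank ℂ V) (hV' : Module.finrank ℂ V ≤ 2)
    {G : Fin 2 × Fin 2 → ℂ} (hG : G ∈ V) (hdet : det2 G ≠ 0) :
    ∃ (P : Matrix (Fin 2 × Fin 2) (Fin 2) ℂ) (L : Matrix (Fin 2) (Fin 2 × Fin 2) ℂ),
      Nonempty (NormalPair P) ∧ L * P = 1 ∧ ∀ v ∈ V, P *ᵥ L *ᵥ v = v := by
  obtain ⟨r, r', hr, hr', T, P, hP, hsum⟩ := exists_normal_form hV hG hdet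
  obtain ⟨L, hL⟩ := exists_leftInverse_of_normal hsum
  exact ⟨P, L, ⟨⟨r, r', T, hr, hr', hsum⟩⟩, hL, fun v hv => mulVec_leftInverse_eq hV' hL hP hv⟩

/-- Simultaneous factorization of three consistent coefficient matrices through three pencils; each
of the three middle factors is determined by the other two. -/
theorem exists_factorization {M₁ M₂ M₃ : Matrix (Fin 2 × Fin 2) (Fin 2 × Fin 2) ℂ}
    (h₁ : IsQuadEquation (quad M₁)) (h₂ : IsQuadEquation (quad M₂)) (h₃ : IsQuadEquation (quad M₃))
    (hc₁ : Consistent M₁ M₂ M₃ᵀ) (hc₂ : Consistent M₂ M₃ M₁ᵀ) (hc₃ : Consistent M₃ M₁ M₂ᵀ) :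
    ∃ (P R T : Matrix (Fin 2 × Fin 2) (Fin 2) ℂ) (A B D : Matrix (Fin 2) (Fin 2) ℂ),
      Nonempty (NormalPair P) ∧ Nonempty (NormalPair R) ∧ Nonempty (NormalPair T) ∧
        M₁ = P * A * Rᵀ ∧ M₂ = R * B * Tᵀ ∧ M₃ = T * D * Pᵀ ∧
        (∃ k : ℂ, k ≠ 0 ∧ Dᵀ = k • (A * !![0, 1; -1, 0] * B)) ∧
        (∃ k : ℂ, k ≠ 0 ∧ Aᵀ = k • (B * !![0, 1; -1, 0] * D)) ∧
        ∃ k : ℂ, k ≠ 0 ∧ Bᵀ = k • (D * !![0, 1; -1, 0] * A) := by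
  -- Two equations meeting at a pair have the same range there: one inclusion comes from `hc`, the
  -- other from the transpose of `hc'`. The common pencil has dimension 2.
  have frame : ∀ {M M' N N'}, IsQuadEquation (quad M) → IsQuadEquation (quad M') →
      IsQuadEquation (quad N) → Consistent M N M' → Consistent N' M'ᵀ Mᵀ →
      IsQuadEquation (quad N') →
      ∃ (P : Matrix (Fin 2 × Fin 2) (Fin 2) ℂ) (L : Matrix (Fin 2) (Fin 2 × Fin 2) ℂ),
        Nonempty (NormalPair P) ∧ L * P = 1 ∧
        (∀ v ∈ LinearMap.range M.mulVecLin, P *ᵥ L *ᵥ v = v) ∧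
        ∀ v ∈ LinearMap.range M'.mulVecLin, P *ᵥ L *ᵥ v = v := by
    intro M M' N N' hM hM' hN hc hc' hN'
    obtain ⟨hle, hfin⟩ := hc.range_le hM'.ne_vecMulVec hM.detPoly_ne_zero hN.transpose.detPoly_ne_zero
    obtain ⟨hle', -⟩ := hc'.transpose.range_le (by simpa using hM.ne_vecMulVec)
      (by simpa using hM'.detPoly_ne_zero) (by simpa using hN'.detPoly_ne_zero)
    simp only [transpose_transpose] at hle'
    rw [← le_antisymm hle hle'] at hfin ⊢
    obtain ⟨v, hv, -⟩ := exists_generic hM.detPoly_ne_zero hM.detPoly_ne_zero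
    rw [eval_detPoly] at hv
    obtain ⟨P, L, hP, hL, hPL⟩ :=
      exists_frame (two_le_finrank_range hM.ne_vecMulVec) hfin ⟨_, rfl⟩ hv
    exact ⟨P, L, hP, hL, hPL, hPL⟩
  obtain ⟨P, L, hP, hL, hP₁, hP₃⟩ := frame h₁ h₃.transpose h₂ hc₁ (by simpa using hc₂) h₂
  obtain ⟨R, K, hR, hK, hR₂, hR₁⟩ := frame h₂ h₁.transpose h₃ hc₂ (by simpa using hc₃) h₃
  obtain ⟨T, N, hT, hN, hT₃, hT₂⟩ := frame h₃ h₂.transpose h₁ hc₃ (by simpa using hc₁) h₁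
  have e₁ := eq_mul_mul_transpose hP₁ hR₁
  have e₂ := eq_mul_mul_transpose hR₂ hT₂
  have e₃ := eq_mul_mul_transpose hT₃ hP₃
  have dA := det_ne_zero_of_ne_vecMulVec h₁.ne_vecMulVec e₁
  have dB := det_ne_zero_of_ne_vecMulVec h₂.ne_vecMulVec e₂
  have dD := det_ne_zero_of_ne_vecMulVec h₃.ne_vecMulVec e₃
  generalize L * M₁ * Kᵀ = A at e₁ dA
  generalize K * M₂ * Nᵀ = B at e₂ dB
  generalize N * M₃ * Lᵀ = D at e₃ dD
  have hne : ∀ {Z : Matrix (Fin 2) (Fin 2) ℂ}, Z.det ≠ 0 → Zᵀ ≠ 0 := fun hZ h0 =>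
    hZ (by rw [← det_transpose, h0]; simp)
  have htr : ∀ {M : Matrix (Fin 2 × Fin 2) (Fin 2 × Fin 2) ℂ}
      {X Y : Matrix (Fin 2 × Fin 2) (Fin 2) ℂ} {Z : Matrix (Fin 2) (Fin 2) ℂ},
      M = X * Z * Yᵀ → Mᵀ = Y * Zᵀ * Xᵀ := by
    rintro M X Y Z rfl
    simp only [transpose_mul, transpose_transpose, Matrix.mul_assoc]
  exact ⟨P, R, T, A, B, D, hP, hR, hT, e₁, e₂, e₃,
    hc₁.exists_eq_smul h₁.detPoly_ne_zero h₂.transpose.detPoly_ne_zero hL hK hN e₁ e₂ (htr e₃)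
      dA dB (hne dD),
    hc₂.exists_eq_smul h₂.detPoly_ne_zero h₃.transpose.detPoly_ne_zero hK hN hL e₂ e₃ (htr e₁)
      dB dD (hne dA),
    hc₃.exists_eq_smul h₃.detPoly_ne_zero h₁.transpose.detPoly_ne_zero hN hL hK e₃ e₁ (htr e₂)
      dD dA (hne dB)⟩

/-! ### From consistency around the octahedron to matrices -/

/-- Among all admissible choices of variables to solve for, the single choice of `x` and `z` is
enough. -/
theorem consistent_of_obtainedFrom {M₁ M₂ : Matrix (Fin 2 × Fin 2) (Fin 2 × Fin 2) ℂ}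
    (h₁ : IsQuadEquation (quad M₁)) (h₂ : IsQuadEquation (quad M₂))
    {M₃ : Matrix (Fin 2 × Fin 2) (Fin 2 × Fin 2) ℂ} {x x' y y' z z' : Fin 6}
    (hinj : Function.Injective ![x, x', y, y', z, z'])
    (h : ObtainedFrom (rename ![z, x, z', x'] (quad M₃)) (rename ![x, y, x', y'] (quad M₁))
      (rename ![y, z, y', z'] (quad M₂))) : Consistent M₁ M₂ M₃ᵀ := by
  have hbij : Function.Bijective ![x, x', y, y', z, z'] := Finite.injective_iff_bijective.1 hinj
  have hne : ∀ i j, i ≠ j → ![x, x', y, y', z, z'] i ≠ ![x, x', y, y', z, z'] j :=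
    fun i j hij => hinj.ne hij
  have hf₁ : Function.Injective ![x, y, x', y'] := by
    have := hinj.comp (show Function.Injective (![0, 2, 1, 3] : Fin 4 → Fin 6) by decide)
    convert this using 1
    funext i
    fin_cases i <;> rfl
  have hf₂ : Function.Injective ![y, z, y', z'] := by
    have := hinj.comp (show Function.Injective (![2, 4, 3, 5] : Fin 4 → Fin 6) by decide)
    convert this using 1
    funext i
    fin_cases i <;> rfl
  intro a a' b b' c c' d₁ d₂ e₁ e₂
  let v : Fin 6 → ℂ := ![a, a', b, b', c, c'] ∘ (Equiv.ofBijective _ hbij).symm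
  have hv : ∀ i, v (![x, x', y, y', z, z'] i) = ![a, a', b, b', c, c'] i := fun i =>
    congrArg ![a, a', b, b', c, c'] ((Equiv.ofBijective _ hbij).symm_apply_apply i)
  have hx : v x = a := hv 0
  have hx' : v x' = a' := hv 1
  have hy : v y = b := hv 2
  have hy' : v y' = b' := hv 3
  have hz : v z = c := hv 4
  have hz' : v z' = c' := hv 5
  have hxz : x ≠ y ∧ x ≠ z ∧ x ≠ y' ∧ x ≠ z' := ⟨hne 0 2 (by decide), hne 0 4 (by decide),
    hne 0 3 (by decide), hne 0 5 (by decide)⟩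
  have hzx : z ≠ x ∧ z ≠ y ∧ z ≠ x' ∧ z ≠ y' := ⟨hne 4 0 (by decide), hne 4 2 (by decide),
    hne 4 1 (by decide), hne 4 3 (by decide)⟩
  have key := h x ?_ z ?_ v ?_ ?_ ?_ ?_
  · rw [eval_rename, eval_quad, dotProduct_mulVec_comm] at key
    simpa [hx, hx', hz, hz'] using key
  · rw [Finset.mem_sdiff, mem_vars_iff_degreeOf_ne_zero, mem_vars_iff_degreeOf_ne_zero, not_not]
    constructor
    · have := degreeOf_rename_of_injective (p := quad M₁) hf₁ 0
      rw [h₁.2 0] at this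
      change degreeOf (![x, y, x', y'] 0) _ ≠ 0
      rw [this]
      exact one_ne_zero
    · exact degreeOf_rename_of_notMem_range (by simp [hxz]) _
  · rw [Finset.mem_sdiff, mem_vars_iff_degreeOf_ne_zero, mem_vars_iff_degreeOf_ne_zero, not_not]
    constructor
    · have := degreeOf_rename_of_injective (p := quad M₂) hf₂ 1
      rw [h₂.2 1] at this
      change degreeOf (![y, z, y', z'] 1) _ ≠ 0
      rw [this]
      exact one_ne_zero
    · exact degreeOf_rename_of_notMem_range (by simp [hzx]) _
  · have := pderiv_rename hf₁ 0 (quad M₁)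
    change eval v (pderiv (![x, y, x', y'] 0) _) ≠ 0
    rw [this, eval_rename, eval_pderiv_zero_quad]
    simpa [hx', hy, hy'] using d₁
  · have := pderiv_rename hf₂ 1 (quad M₂)
    change eval v (pderiv (![y, z, y', z'] 1) _) ≠ 0
    rw [this, eval_rename, eval_pderiv_one_quad]
    simpa [hz', hy, hy'] using d₂
  · rw [eval_rename, eval_quad]
    simpa [hx, hx', hy, hy'] using e₁
  · rw [eval_rename, eval_quad]
    simpa [hz, hz', hy, hy'] using e₂

theorem ObtainedFrom.symm {R P Q : MvPolynomial (Fin 6) ℂ} (h : ObtainedFrom R P Q) :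
    ObtainedFrom R Q P := fun a ha b hb v h1 h2 h3 h4 => h b hb a ha v h2 h1 h4 h3

theorem consistent_of_hasCAO {M₁ M₂ M₃ : Matrix (Fin 2 × Fin 2) (Fin 2 × Fin 2) ℂ}
    (h₁ : IsQuadEquation (quad M₁)) (h₂ : IsQuadEquation (quad M₂)) (h₃ : IsQuadEquation (quad M₃))
    (h : HasCAO (octahedron (quad M₁) (quad M₂) (quad M₃))) :
    Consistent M₁ M₂ M₃ᵀ ∧ Consistent M₂ M₃ M₁ᵀ ∧ Consistent M₃ M₁ M₂ᵀ := by
  obtain ⟨c₂, c₃, c₁⟩ := h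
  refine ⟨?_, ?_, ?_⟩
  · exact consistent_of_obtainedFrom (x := 4) (x' := 1) (y := 2) (y' := 5) (z := 6) (z' := 3)
      h₁ h₂ (by decide) c₁
  · exact consistent_of_obtainedFrom (x := 2) (x' := 5) (y := 6) (y' := 3) (z := 4) (z' := 1)
      h₂ h₃ (by decide) c₂
  · exact consistent_of_obtainedFrom (x := 6) (x' := 3) (y := 4) (y' := 1) (z := 2) (z' := 5)
      h₃ h₁ (by decide) c₃.symm

/-! ### The Möbius action on quad-equations -/

theorem coeff_quad (M : Matrix (Fin 2 × Fin 2) (Fin 2 × Fin 2) ℂ) (I J : Fin 2 × Fin 2) :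
    (quad M).coeff (expo (pairsEquiv (I, J))) = M I J := by
  classical
  simp only [quad, ← monomial_expo_pairs, coeff_sum, coeff_monomial, expo_injective.eq_iff,
    pairsEquiv.injective.eq_iff, Prod.mk.injEq]
  rw [Finset.sum_eq_single I (fun I' _ hI => Finset.sum_eq_zero fun J' _ => by simp [hI]) (by simp),
    Finset.sum_eq_single J (fun J' _ hJ => by simp [hJ]) (by simp)]
  simp

theorem homog_eq_pow (r : Matrix (Fin 2) (Fin 2) ℂ) (x : MvPolynomial (Fin 6) ℂ) (i : Fin 2) :
    homog r x i = (C (r 0 0) * x + C (r 0 1)) ^ (i : ℕ) *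
      (C (r 1 0) * x + C (r 1 1)) ^ (1 - (i : ℕ)) := by
  fin_cases i <;> simp [homog]

/-- Degree exactly one in each occurring variable means that clearing denominators replaces `1` and
`u i` by the denominator and the numerator; the other variables contribute trivial factors. -/
theorem mobius_rename_quad {M : Matrix (Fin 2 × Fin 2) (Fin 2 × Fin 2) ℂ}
    (hM : IsQuadEquation (quad M)) {f : Fin 4 → Fin 6} (hf : Function.Injective f)
    (r : Fin 6 → Matrix (Fin 2) (Fin 2) ℂ) :
    mobius r (rename f (quad M)) = ∑ I, ∑ J, C (M I J) *
      ((homog (r (f 0)) (u (f 0)) I.1 * homog (r (f 2)) (u (f 2)) I.2) *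
       (homog (r (f 1)) (u (f 1)) J.1 * homog (r (f 3)) (u (f 3)) J.2)) := by
  classical
  have hprod : ∀ m : Fin 4 →₀ ℕ,
      ∏ i, (C (r i 0 0) * u i + C (r i 0 1)) ^ (m.mapDomain f) i *
        (C (r i 1 0) * u i + C (r i 1 1)) ^
          ((rename f (quad M)).degreeOf i - (m.mapDomain f) i) =
      ∏ k, (C (r (f k) 0 0) * u (f k) + C (r (f k) 0 1)) ^ m k *
        (C (r (f k) 1 0) * u (f k) + C (r (f k) 1 1)) ^ (1 - m k) := by
    intro m
    symm
    refine Fintype.prod_of_injective f hf _ _ (fun i hi => ?_) fun k => ?_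
    · rw [Finsupp.mapDomain_of_notMem_range _ _ hi, degreeOf_rename_of_notMem_range hi]
      simp
    · rw [Finsupp.mapDomain_apply hf, degreeOf_rename_of_injective hf, hM.2 k]
  rw [mobius, support_rename_of_injective hf,
    Finset.sum_image fun a _ b _ h => Finsupp.mapDomain_injective hf h]
  simp only [coeff_rename_mapDomain f hf, hprod]
  rw [sum_support_eq_sum_pairs (fun i => (hM.2 i).le)
    (fun m c => C c * ∏ k, (C (r (f k) 0 0) * u (f k) + C (r (f k) 0 1)) ^ m k *
        (C (r (f k) 1 0) * u (f k) + C (r (f k) 1 1)) ^ (1 - m k)) (by simp)]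
  refine Finset.sum_congr rfl fun I _ => Finset.sum_congr rfl fun J _ => ?_
  rw [coeff_quad]
  simp only [homog_eq_pow, Fin.prod_univ_four, pairsEquiv_apply, expo,
    Finsupp.equivFunOnFinite_symm_apply_apply, cons_val]
  ring

/-- The bilinear expression `∑ A a b n_a n'_b`. -/
noncomputable def bilin (A : Matrix (Fin 2) (Fin 2) ℂ) (n n' : Fin 2 → MvPolynomial (Fin 6) ℂ) :
    MvPolynomial (Fin 6) ℂ :=
  ∑ a, ∑ b, C (A a b) * (n a * n' b)

theorem sum_mul_mul_transpose (P R : Matrix (Fin 2 × Fin 2) (Fin 2) ℂ)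
    (A : Matrix (Fin 2) (Fin 2) ℂ) (g g' : Fin 2 × Fin 2 → MvPolynomial (Fin 6) ℂ) :
    ∑ I, ∑ J, C ((P * A * Rᵀ) I J) * (g I * g' J) =
      bilin A (fun a => ∑ I, C (P I a) * g I) (fun b => ∑ J, C (R J b) * g' J) := by
  simp only [bilin, mul_apply, transpose_apply, Fin.sum_univ_two, Fintype.sum_prod_type, map_add,
    map_mul]
  ring

theorem mobius_rename_quad_eq_bilin {P R : Matrix (Fin 2 × Fin 2) (Fin 2) ℂ}
    {A : Matrix (Fin 2) (Fin 2) ℂ} (hM : IsQuadEquation (quad (P * A * Rᵀ)))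
    (p : NormalPair P) (q : NormalPair R) {f : Fin 4 → Fin 6} (hf : Function.Injective f)
    {r : Fin 6 → Matrix (Fin 2) (Fin 2) ℂ} (h0 : r (f 0) = p.r) (h2 : r (f 2) = p.r')
    (h1 : r (f 1) = q.r) (h3 : r (f 3) = q.r') :
    mobius r (rename f (quad (P * A * Rᵀ))) =
      bilin A (normal p.T (u (f 0)) (u (f 2))) (normal q.T (u (f 1)) (u (f 3))) := by
  rw [mobius_rename_quad hM hf, h0, h1, h2, h3, sum_mul_mul_transpose P R A
    (fun I => homog p.r (u (f 0)) I.1 * homog p.r' (u (f 2)) I.2)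
    (fun J => homog q.r (u (f 1)) J.1 * homog q.r' (u (f 3)) J.2)]
  simp only [p.sum_eq, q.sum_eq]

/-! ### Assembling the classification -/

/-- `E` is equivalent to one of the four normal systems. -/
def Classified (E : Fin 3 → MvPolynomial (Fin 6) ℂ) : Prop :=
  ∃ α₁ α₂ α₃ α₄ α₅ α₆ α₇ α₈ : ℂ,
    OctEquiv E (systemN333 α₁ α₂ α₃ α₄ α₅ α₆ α₇ α₈) ∨
    OctEquiv E (systemN223 α₁ α₂ α₃ α₄ α₅ α₆ α₇ α₈) ∨
    OctEquiv E (systemN221 α₁ α₂ α₃ α₄ α₅ α₆ α₇ α₈) ∨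
    OctEquiv E (systemN111 α₁ α₂ α₃ α₄ α₅ α₆ α₇ α₈)

theorem octEquiv_of_mobius {Q₁ Q₂ Q₃ : MvPolynomial (Fin 4) ℂ}
    {E' : Fin 3 → MvPolynomial (Fin 6) ℂ}
    {r : Fin 6 → Matrix (Fin 2) (Fin 2) ℂ} (hr : ∀ i, (r i).det ≠ 0) {c : ℂ} (hc : c ≠ 0)
    (h₀ : E' 0 = mobius r (rename ![4, 2, 1, 5] Q₁))
    (h₁ : E' 1 = mobius r (rename ![2, 6, 5, 3] Q₂))
    (h₂ : C c * E' 2 = mobius r (rename ![6, 4, 3, 1] Q₃)) :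
    OctEquiv (octahedron Q₁ Q₂ Q₃) E' := by
  refine ⟨r, hr, 1, one_mem _, 1, fun i => ?_⟩
  have hid : ∀ p : MvPolynomial (Fin 6) ℂ, rename (1 : Equiv.Perm (Fin 6)) p = p := fun p => by
    rw [Equiv.Perm.coe_one, rename_id_apply]
  fin_cases i
  · refine ⟨1, one_ne_zero, ?_⟩
    rw [hid, map_one, one_mul]
    exact h₀
  · refine ⟨1, one_ne_zero, ?_⟩
    rw [hid, map_one, one_mul]
    exact h₁
  · refine ⟨c⁻¹, inv_ne_zero hc, ?_⟩
    rw [hid]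
    change E' 2 = C c⁻¹ * mobius r (rename ![6, 4, 3, 1] Q₃)
    rw [← h₂, ← mul_assoc, ← map_mul, inv_mul_cancel₀ hc, map_one, one_mul]

/-- The parameters are the entries of `A` and `B`, and the third equation has coefficients
proportional to the entries of `A J B`. The common type of `p, t` and the type of `q` select one of
the four systems. The scale is `-k` in the last three because their listed coefficients are the
entries of `-A J B`. -/
theorem classified_of_factorization {P R T : Matrix (Fin 2 × Fin 2) (Fin 2) ℂ}
    {A B D : Matrix (Fin 2) (Fin 2) ℂ} (h₁ : IsQuadEquation (quad (P * A * Rᵀ)))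
    (h₂ : IsQuadEquation (quad (R * B * Tᵀ))) (h₃ : IsQuadEquation (quad (T * D * Pᵀ)))
    (p : NormalPair P) (q : NormalPair R) (t : NormalPair T) (hpt : p.T = t.T)
    {k : ℂ} (hk : k ≠ 0) (hD : Dᵀ = k • (A * !![0, 1; -1, 0] * B)) :
    Classified (octahedron (quad (P * A * Rᵀ)) (quad (R * B * Tᵀ)) (quad (T * D * Pᵀ))) := by
  obtain ⟨r, h1, h4, h2, h5, h6, h3⟩ : ∃ r : Fin 6 → Matrix (Fin 2) (Fin 2) ℂ,
      r 1 = p.r' ∧ r 4 = p.r ∧ r 2 = q.r ∧ r 5 = q.r' ∧ r 6 = t.r ∧ r 3 = t.r' :=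
    ⟨![t.r, p.r', q.r, t.r', p.r, q.r'], rfl, rfl, rfl, rfl, rfl, rfl⟩
  have hr : ∀ i, (r i).det ≠ 0 := by
    intro i
    fin_cases i
    · exact h6 ▸ t.det_ne_zero
    · exact h1 ▸ p.det_ne_zero'
    · exact h2 ▸ q.det_ne_zero
    · exact h3 ▸ t.det_ne_zero'
    · exact h4 ▸ p.det_ne_zero
    · exact h5 ▸ q.det_ne_zero'
  have e₁ := mobius_rename_quad_eq_bilin h₁ p q (f := ![4, 2, 1, 5]) (by decide) h4 h1 h2 h5
  have e₂ := mobius_rename_quad_eq_bilin h₂ q t (f := ![2, 6, 5, 3]) (by decide) h2 h5 h6 h3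
  have e₃ := mobius_rename_quad_eq_bilin h₃ t p (f := ![6, 4, 3, 1]) (by decide) h6 h3 h4 h1
  have hDe : ∀ i j, (C (D j i) : MvPolynomial (Fin 6) ℂ) =
      C k * C ((A * !![0, 1; -1, 0] * B : Matrix (Fin 2) (Fin 2) ℂ) i j) :=
    fun i j => by rw [← map_mul]; exact congrArg C (congrFun (congrFun hD i) j)
  have d00 := hDe 0 0
  have d01 := hDe 0 1
  have d10 := hDe 1 0
  have d11 := hDe 1 1
  simp [mul_apply, Fin.sum_univ_two] at d00 d01 d10 d11
  simp only [cons_val] at e₁ e₂ e₃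
  cases hp : p.T <;> cases hq : q.T <;> rw [← hpt, hp] at e₂ e₃ <;> rw [hp] at e₁ <;>
    rw [hq] at e₁ e₂ <;>
    simp only [bilin, normal, Fin.sum_univ_two, cons_val_zero, cons_val_one, if_true,
      Bool.false_eq_true, if_false, d00, d01, d10, d11] at e₁ e₂ e₃
  · refine ⟨A 0 0, A 1 1, A 0 1, A 1 0, B 0 0, B 1 1, B 0 1, B 1 0, Or.inl
      (octEquiv_of_mobius hr (c := k) hk ?_ ?_ ?_)⟩
    · simp only [e₁, systemN333, N3, cons_val]
      ring
    · simp only [e₂, systemN333, N3, cons_val]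
      ring
    · simp only [e₃, systemN333, N3, cons_val, map_sub, map_mul]
      ring
  · refine ⟨A 0 0, A 1 0, A 0 1, A 1 1, B 0 0, B 0 1, B 1 0, B 1 1, Or.inr (Or.inl
      (octEquiv_of_mobius hr (c := -k) (neg_ne_zero.2 hk) ?_ ?_ ?_))⟩
    · simp only [e₁, systemN223, N2, cons_val]
      ring
    · simp only [e₂, systemN223, N2, cons_val]
      ring
    · simp only [e₃, systemN223, N3, cons_val, map_sub, map_mul, map_neg]
      ring
  · refine ⟨A 0 0, A 0 1, A 1 0, A 1 1, B 0 0, B 1 0, B 0 1, B 1 1, Or.inr (Or.inr (Or.inl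
      (octEquiv_of_mobius hr (c := -k) (neg_ne_zero.2 hk) ?_ ?_ ?_)))⟩
    · simp only [e₁, systemN221, N2, cons_val]
      ring
    · simp only [e₂, systemN221, N2, cons_val]
      ring
    · simp only [e₃, systemN221, N1, cons_val, map_sub, map_mul, map_neg]
      ring
  · refine ⟨A 0 0, A 0 1, A 1 0, A 1 1, B 0 0, B 0 1, B 1 0, B 1 1, Or.inr (Or.inr (Or.inr
      (octEquiv_of_mobius hr (c := -k) (neg_ne_zero.2 hk) ?_ ?_ ?_)))⟩
    · simp only [e₁, systemN111, N1, cons_val]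
      ring
    · simp only [e₂, systemN111, N1, cons_val]
      ring
    · simp only [e₃, systemN111, N1, cons_val, map_sub, map_mul, map_neg]
      ring

/-- The rotation of the octahedron that permutes the three pairs of opposite vertices cyclically. -/
def rotation : Equiv.Perm (Fin 6) where
  toFun := ![4, 5, 6, 1, 2, 3]
  invFun := ![2, 3, 4, 5, 6, 1]
  left_inv := by decide
  right_inv := by decide

theorem rotation_mem : rotation ∈ octahedralGroup := by
  have h : rotation = Equiv.swap 1 4 * Equiv.swap 2 5 * [1, 3, 4, 6].formPerm *
      [1, 2, 4, 5].formPerm := by decide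
  rw [h]
  refine mul_mem (mul_mem (mul_mem ?_ ?_) ?_) ?_ <;> exact Subgroup.subset_closure (by simp)

theorem octahedron_rotate (Q₁ Q₂ Q₃ : MvPolynomial (Fin 4) ℂ) (i : Fin 3) :
    octahedron Q₃ Q₁ Q₂ i = rename rotation (octahedron Q₁ Q₂ Q₃ (i - 1)) := by
  have key : ∀ (f g : Fin 4 → Fin 6) (Q : MvPolynomial (Fin 4) ℂ), g = rotation ∘ f →
      rename g Q = rename rotation (rename f Q) := fun f g Q h => by rw [rename_rename, h]
  fin_cases i
  · exact key ![6, 4, 3, 1] ![4, 2, 1, 5] Q₃ (by decide)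
  · exact key ![4, 2, 1, 5] ![2, 6, 5, 3] Q₁ (by decide)
  · exact key ![2, 6, 5, 3] ![6, 4, 3, 1] Q₂ (by decide)

theorem OctEquiv.of_rotate {Q₁ Q₂ Q₃ : MvPolynomial (Fin 4) ℂ}
    {E' : Fin 3 → MvPolynomial (Fin 6) ℂ} (h : OctEquiv (octahedron Q₃ Q₁ Q₂) E') :
    OctEquiv (octahedron Q₁ Q₂ Q₃) E' := by
  obtain ⟨r, hr, σ, hσ, τ, h⟩ := h
  refine ⟨r, hr, σ * rotation, mul_mem hσ rotation_mem, τ.trans (Equiv.subRight 1), fun i => ?_⟩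
  obtain ⟨c, hc, hi⟩ := h i
  refine ⟨c, hc, ?_⟩
  rw [hi, octahedron_rotate, rename_rename]
  rfl

theorem Classified.of_rotate {Q₁ Q₂ Q₃ : MvPolynomial (Fin 4) ℂ}
    (h : Classified (octahedron Q₃ Q₁ Q₂)) : Classified (octahedron Q₁ Q₂ Q₃) := by
  obtain ⟨α₁, α₂, α₃, α₄, α₅, α₆, α₇, α₈, h⟩ := h
  exact ⟨α₁, α₂, α₃, α₄, α₅, α₆, α₇, α₈, h.imp OctEquiv.of_rotate
    (Or.imp OctEquiv.of_rotate (Or.imp OctEquiv.of_rotate OctEquiv.of_rotate))⟩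

theorem classified_of_hasCAO {Q₁ Q₂ Q₃ : MvPolynomial (Fin 4) ℂ}
    (h₁ : IsQuadEquation Q₁) (h₂ : IsQuadEquation Q₂) (h₃ : IsQuadEquation Q₃)
    (hCAO : HasCAO (octahedron Q₁ Q₂ Q₃)) : Classified (octahedron Q₁ Q₂ Q₃) := by
  obtain ⟨M₁, rfl⟩ := exists_eq_quad fun i => (h₁.2 i).le
  obtain ⟨M₂, rfl⟩ := exists_eq_quad fun i => (h₂.2 i).le
  obtain ⟨M₃, rfl⟩ := exists_eq_quad fun i => (h₃.2 i).le
  obtain ⟨c₁, c₂, c₃⟩ := consistent_of_hasCAO h₁ h₂ h₃ hCAO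
  obtain ⟨P, R, T, A, B, D, ⟨p⟩, ⟨q⟩, ⟨t⟩, rfl, rfl, rfl, ⟨k₁, hk₁, e₁⟩, ⟨k₂, hk₂, e₂⟩,
    ⟨k₃, hk₃, e₃⟩⟩ := exists_factorization h₁ h₂ h₃ c₁ c₂ c₃
  -- Of three Boolean types two coincide; rotations move the coinciding pairs to the position
  -- required above.
  by_cases hpt : p.T = t.T
  · exact classified_of_factorization h₁ h₂ h₃ p q t hpt hk₁ e₁
  by_cases htq : t.T = q.T
  · exact (classified_of_factorization h₃ h₁ h₂ t p q htq hk₃ e₃).of_rotate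
  · have hqp : q.T = p.T := by
      revert hpt htq
      cases p.T <;> cases q.T <;> cases t.T <;> simp
    exact (classified_of_factorization h₂ h₃ h₁ q t p hqp hk₂ e₂).of_rotate.of_rotate

end CAO

theorem mainTheorem2 (Q₁ Q₂ Q₃ : MvPolynomial (Fin 4) ℂ)
    (h₁ : CAO.IsQuadEquation Q₁) (h₂ : CAO.IsQuadEquation Q₂) (h₃ : CAO.IsQuadEquation Q₃)
    (hCAO : CAO.HasCAO (CAO.octahedron Q₁ Q₂ Q₃)) :
    ∃ α₁ α₂ α₃ α₄ α₅ α₆ α₇ α₈ : ℂ,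
      CAO.OctEquiv (CAO.octahedron Q₁ Q₂ Q₃) (CAO.systemN333 α₁ α₂ α₃ α₄ α₅ α₆ α₇ α₈) ∨
      CAO.OctEquiv (CAO.octahedron Q₁ Q₂ Q₃) (CAO.systemN223 α₁ α₂ α₃ α₄ α₅ α₆ α₇ α₈) ∨
      CAO.OctEquiv (CAO.octahedron Q₁ Q₂ Q₃) (CAO.systemN221 α₁ α₂ α₃ α₄ α₅ α₆ α₇ α₈) ∨
      CAO.OctEquiv (CAO.octahedron Q₁ Q₂ Q₃) (CAO.systemN111 α₁ α₂ α₃ α₄ α₅ α₆ α₇ α₈) := by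
  exact CAO.classified_of_hasCAO h₁ h₂ h₃ hCAO
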